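/- Let $K$ be a field of characteristic $0$ (for instance $K=\mathbb{C}(d)$ with $d$ an indeterminate, or $K=\mathbb{C}$), let $n\ge 1$, and let $d\in K$ with $d\notin\{0,-2,-4,\dots,-2n+4\}$ (no condition for $n=1$). Let $VTL_n(d)$ be the $n$-strand virtual Temperley–Lieb algebra (the Brauer algebra): the $K$-vector space whose basis is the set of Brauer diagrams, i.e. perfect matchings (by "strands") of a row of $n$ top points and a row of $n$ bottom points, with product given by stacking the first diagram on top of the second and replacing each closed curve by a factor $d$. For $1\le i\le n-1$ let $e_i$ be the diagram joining the points $i,i+1$ of the top row, joining the points $i,i+1$ of the bottom row, and having vertical strands elsewhere; let $v_i$ be the diagram joining top point $i$ to bottom point $i+1$ and top point $i+1$ to bottom point $i$, with vertical strands elsewhere. Define $f_1,\dots,f_n\in VTL_n(d)$ recursively by $f_1=1_n$ and, for $2\le i\le n$, $$f_i=x_{i-1}f_{i-1}+y_{i-1}f_{i-1}e_{i-1}f_{i-1}+z_{i-1}f_{i-1}v_{i-1}f_{i-1},$$ where $x_i=\frac1{i+1}$, $y_i=-\frac{2i}{(i+1)(d+2i-2)}$, $z_i=\frac{i}{i+1}$.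 For $0\le k\le n$ let $[k]_n\in VTL_n(d)$ be the sum of all Brauer diagrams with exactly $k$ through strands (strands joining a top point to a bottom point). Then $$f_n=\sum_{l=0}^{\lfloor n/2\rfloor}\frac{(-2)^l\,l!}{n!\prod_{i=1}^{l}(d+2n-2-2i)}\,[n-2l]_n .$$ -/

import Mathlib

open Finset

/-- A Brauer diagram (connection element) on `n` top points `Sum.inl i` and `n` bottom points
`Sum.inr i`: a perfect matching of the `2 n` points, given as the fixed-point-free involution
that sends each point to the other end of its strand. -/
abbrev BrauerDiagram (n : ℕ) : Type :=
  {σ : Fin n ⊕ Fin n → Fin n ⊕ Fin n // Function.Involutive σ ∧ ∀ p, σ p ≠ p}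

instance (n : ℕ) : Fintype (BrauerDiagram n) :=
  inferInstanceAs (Fintype {σ : Fin n ⊕ Fin n → Fin n ⊕ Fin n //
    (∀ p, σ (σ p) = p) ∧ ∀ p, σ p ≠ p})

namespace BrauerDiagram

/-- The points of two stacked rectangles: top, middle and bottom row. -/
inductive Stack (n : ℕ) : Type
  | top (i : Fin n) : Stack n
  | mid (i : Fin n) : Stack n
  | bot (i : Fin n) : Stack n

variable {n : ℕ}

/-- The boundary points of the upper rectangle inside the stack. -/
def upper : Fin n ⊕ Fin n → Stack n
  | Sum.inl i => Stack.top i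
  | Sum.inr i => Stack.mid i

/-- The boundary points of the lower rectangle inside the stack. -/
def lower : Fin n ⊕ Fin n → Stack n
  | Sum.inl i => Stack.mid i
  | Sum.inr i => Stack.bot i

/-- The boundary points of the whole stack. -/
def outer : Fin n ⊕ Fin n → Stack n
  | Sum.inl i => Stack.top i
  | Sum.inr i => Stack.bot i

/-- The strands of the stack with `D` in the upper and `E` in the lower rectangle. -/
inductive Strand (D E : BrauerDiagram n) : Stack n → Stack n → Prop
  | upper (a : Fin n ⊕ Fin n) : Strand D E (upper a) (upper (D.1 a))
  | lower (a : Fin n ⊕ Fin n) : Strand D E (lower a) (lower (E.1 a))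

/-- The equivalence relation on the points of the stack whose classes are the connected
components of the stacked curves. -/
def component (D E : BrauerDiagram n) : Setoid (Stack n) :=
  Relation.EqvGen.setoid (Strand D E)

/-- The number of closed curves in the stack: the components that reach no boundary point. -/
noncomputable def loops (D E : BrauerDiagram n) : ℕ :=
  Nat.card {c : Quotient (component D E) // ∀ a, Quotient.mk (component D E) (outer a) ≠ c}

/-! Each boundary point of the stack is joined to exactly one other boundary point. -/

theorem partner_aux {V : Type*} [Finite V] (α β : V → V) (hα : Function.Involutive α)
    (hβ : Function.Involutive β) (r : V → V → Prop)
    (hrα : ∀ p, Relation.EqvGen r p (α p)) (hrβ : ∀ p, Relation.EqvGen r p (β p))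
    (hr : ∀ p q, r p q → q = p ∨ q = α p ∨ q = β p)
    (x : V) (hx : β x = x) (hx' : α x ≠ x) :
    ∃! y, (α y = y ∨ β y = y) ∧ y ≠ x ∧ Relation.EqvGen r x y := by
  let A : Equiv.Perm V := hα.toPerm
  let B : Equiv.Perm V := hβ.toPerm
  have hA : A * A = 1 := by ext p; exact hα p
  have hB : B * B = 1 := by ext p; exact hβ p
  have hAi : A⁻¹ = A := inv_eq_of_mul_eq_one_right hA
  have hBi : B⁻¹ = B := inv_eq_of_mul_eq_one_right hB
  let π : Equiv.Perm V := B * A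
  have hconj : B * π * B⁻¹ = π⁻¹ := by
    simp only [π, mul_inv_rev, hAi, hBi, ← mul_assoc, hB, one_mul]
  have hBk (k : ℤ) : β ((π ^ k) x) = (π ^ (-k)) x := by
    have h : B * π ^ k * B⁻¹ = π ^ (-k) := by rw [← conj_zpow, hconj, inv_zpow, zpow_neg]
    calc β ((π ^ k) x) = (B * π ^ k * B⁻¹) x := by
          rw [hBi]; simp only [Equiv.Perm.mul_apply]
          change _ = B ((π ^ k) (β x)); rw [hx]; rfl
      _ = _ := by rw [h]
  have hAk (k : ℤ) : α ((π ^ k) x) = (π ^ (-(k + 1))) x := by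
    rw [← hBk, add_comm, zpow_add, zpow_one]
    exact (hβ _).symm
  let m : ℕ := Function.minimalPeriod π x
  have hper (k l : ℤ) : (π ^ k) x = (π ^ l) x ↔ (m : ℤ) ∣ k - l := by
    refine Iff.trans ?_ (MulAction.zpow_smul_eq_iff_minimalPeriod_dvd (a := π) (b := x))
    rw [Equiv.Perm.smul_def, sub_eq_neg_add, zpow_add, Equiv.Perm.mul_apply, zpow_neg,
      Equiv.Perm.inv_eq_iff_eq]
  have hm0 : 0 < m := Function.minimalPeriod_pos_of_mem_periodicPts
    (Function.Injective.mem_periodicPts π.injective x)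
  have hm1 : m ≠ 1 := by
    intro h
    have h1 := (hper 1 0).2 (by rw [h]; exact one_dvd _)
    rw [zpow_one, zpow_zero] at h1
    have h2 : β (α x) = x := h1
    exact hx' (hβ.injective (h2.trans hx.symm))
  have horb : ∀ y, Relation.EqvGen r x y ↔ ∃ k : ℤ, (π ^ k) x = y := by
    have hcl : ∀ p q, Relation.EqvGen r p q →
        ((∃ k : ℤ, (π ^ k) x = p) ↔ ∃ k : ℤ, (π ^ k) x = q) := by
      intro p q h
      induction h with
      | rel p q h =>
        rcases hr p q h with rfl | rfl | rfl
        · rfl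
        · constructor
          · rintro ⟨k, rfl⟩; exact ⟨_, (hAk k).symm⟩
          · rintro ⟨k, hk⟩; exact ⟨-(k + 1), by rw [← hAk, hk, hα]⟩
        · constructor
          · rintro ⟨k, rfl⟩; exact ⟨_, (hBk k).symm⟩
          · rintro ⟨k, hk⟩; exact ⟨-k, by rw [← hBk, hk, hβ]⟩
      | refl => rfl
      | symm _ _ _ ih => exact ih.symm
      | trans _ _ _ _ _ ih1 ih2 => exact ih1.trans ih2
    have hstep (p : V) : Relation.EqvGen r p (π p) :=
      (hrα p).trans _ _ _ (hrβ (α p))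
    intro y
    constructor
    · intro h; exact (hcl x y h).1 ⟨0, by simp⟩
    · rintro ⟨k, rfl⟩
      induction k using Int.induction_on with
      | zero => exact Relation.EqvGen.refl _
      | succ k ih =>
        refine ih.trans _ _ _ ?_
        rw [add_comm, zpow_add, zpow_one]
        exact hstep _
      | pred k ih =>
        refine ih.trans _ _ _ (Relation.EqvGen.symm _ _ ?_)
        have := hstep ((π ^ (-(k : ℤ) - 1)) x)
        rwa [← Equiv.Perm.mul_apply, ← zpow_one_add, add_sub_cancel] at this
  have hchar (k : ℤ) : ((α ((π ^ k) x) = (π ^ k) x ∨ β ((π ^ k) x) = (π ^ k) x) ∧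
      (π ^ k) x ≠ x) ↔ (m : ℤ) ∣ k - (m / 2 : ℕ) := by
    have e0 : (π ^ k) x = x ↔ (m : ℤ) ∣ k := by
      have := hper k 0
      simpa using this
    rw [hAk, hBk, hper, hper, Ne, e0]
    constructor
    · rintro ⟨⟨c, hc⟩ | ⟨c, hc⟩, h⟩
      · have h1 : (2 * k + 1) = m * (-c) := by linarith
        rcases Nat.even_or_odd' m with ⟨j, hj | hj⟩
        · exfalso
          have : (2 * k + 1) = 2 * (j * (-c)) := by rw [h1, hj]; push_cast; ring
          omega
        · have hodd : Odd ((m : ℤ) * (-c)) := ⟨k, by linarith⟩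
          obtain ⟨t, ht⟩ := (Int.odd_mul.1 hodd).2
          have h2 : m / 2 = j := by omega
          refine ⟨t, ?_⟩
          rw [h2]
          rw [ht, hj] at h1
          rw [hj]
          push_cast at h1 ⊢
          linarith
      · have h1 : 2 * k = m * (-c) := by linarith
        rcases Nat.even_or_odd' m with ⟨j, hj | hj⟩
        · have h3 : k = j * (-c) := by
            have : 2 * k = 2 * (j * (-c)) := by rw [h1, hj]; push_cast; ring
            linarith
          rcases Int.even_or_odd' (-c) with ⟨t, ht | ht⟩
          · exact absurd ⟨t, by rw [h3, ht, hj]; push_cast; ring⟩ h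
          · refine ⟨t, ?_⟩
            have h2 : m / 2 = j := by omega
            rw [h2, h3, ht, hj]; push_cast; ring
        · exfalso
          have hev : Even ((m : ℤ) * (-c)) := ⟨k, by linarith⟩
          rcases Int.even_mul.1 hev with h2 | ⟨t, ht⟩
          · have : Odd (m : ℤ) := ⟨j, by rw [hj]; push_cast; ring⟩
            exact (Int.not_even_iff_odd.2 this) h2
          · exact h ⟨t, by rw [ht] at h1; linarith⟩
    · rintro ⟨c, hc⟩
      have hk : k = m * c + (m / 2 : ℕ) := by linarith
      refine ⟨?_, ?_⟩
      · rcases Nat.even_or_odd' m with ⟨j, hj | hj⟩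
        · right
          have h2 : m / 2 = j := by omega
          exact ⟨-2 * c - 1, by rw [hk, h2, hj]; push_cast; ring⟩
        · left
          have h2 : m / 2 = j := by omega
          exact ⟨-2 * c - 1, by rw [hk, h2, hj]; push_cast; ring⟩
      · intro h
        rw [hk, dvd_add_right (dvd_mul_right _ _)] at h
        have := Nat.le_of_dvd (by omega) (Int.natCast_dvd_natCast.1 h)
        omega
  refine ⟨(π ^ ((m / 2 : ℕ) : ℤ)) x, ?_, ?_⟩
  · have h := (hchar ((m / 2 : ℕ) : ℤ)).2 (by simp)
    exact ⟨h.1, h.2, (horb _).2 ⟨_, rfl⟩⟩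
  · rintro y ⟨h1, h2, h3⟩
    obtain ⟨k, rfl⟩ := (horb y).1 h3
    exact (hper _ _).2 ((hchar k).1 ⟨h1, h2⟩)

def upStep (D : BrauerDiagram n) : Stack n → Stack n
  | Stack.top i => upper (D.1 (Sum.inl i))
  | Stack.mid i => upper (D.1 (Sum.inr i))
  | Stack.bot i => Stack.bot i

def loStep (E : BrauerDiagram n) : Stack n → Stack n
  | Stack.top i => Stack.top i
  | Stack.mid i => lower (E.1 (Sum.inl i))
  | Stack.bot i => lower (E.1 (Sum.inr i))

theorem upStep_upper (D : BrauerDiagram n) (a : Fin n ⊕ Fin n) :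
    upStep D (upper a) = upper (D.1 a) := by rcases a with i | i <;> rfl

theorem loStep_lower (E : BrauerDiagram n) (a : Fin n ⊕ Fin n) :
    loStep E (lower a) = lower (E.1 a) := by rcases a with i | i <;> rfl

theorem upper_inj : Function.Injective (upper (n := n)) := by
  rintro (i | i) (j | j) h <;> simp_all [upper]

theorem lower_inj : Function.Injective (lower (n := n)) := by
  rintro (i | i) (j | j) h <;> simp_all [lower]

theorem outer_inj : Function.Injective (outer (n := n)) := by
  rintro (i | i) (j | j) h <;> simp_all [outer]

instance : Finite (Stack n) := by
  refine Finite.of_surjective (fun p : (Fin n ⊕ Fin n) ⊕ Fin n =>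
    Sum.elim upper Stack.bot p) ?_
  rintro (i | i | i)
  · exact ⟨Sum.inl (Sum.inl i), rfl⟩
  · exact ⟨Sum.inl (Sum.inr i), rfl⟩
  · exact ⟨Sum.inr i, rfl⟩

theorem existsUnique_partner (D E : BrauerDiagram n) (a : Fin n ⊕ Fin n) :
    ∃! b, b ≠ a ∧ component D E (outer a) (outer b) := by
  have hα : Function.Involutive (upStep D) := by
    have h (c) : upStep D (upStep D (upper c)) = upper c := by
      rw [upStep_upper, upStep_upper, D.2.1]
    rintro (i | i | i)
    · exact h (Sum.inl i)
    · exact h (Sum.inr i)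
    · rfl
  have hβ : Function.Involutive (loStep E) := by
    have h (c) : loStep E (loStep E (lower c)) = lower c := by
      rw [loStep_lower, loStep_lower, E.2.1]
    rintro (i | i | i)
    · rfl
    · exact h (Sum.inl i)
    · exact h (Sum.inr i)
  have hα1 (c) : upStep D (upper c) ≠ upper c := fun h =>
    D.2.2 c (upper_inj ((upStep_upper D c).symm.trans h))
  have hβ1 (c) : loStep E (lower c) ≠ lower c := fun h =>
    E.2.2 c (lower_inj ((loStep_lower E c).symm.trans h))
  have hrα : ∀ p, Relation.EqvGen (Strand D E) p (upStep D p) := by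
    rintro (i | i | i)
    · exact Relation.EqvGen.rel _ _ (Strand.upper (Sum.inl i))
    · exact Relation.EqvGen.rel _ _ (Strand.upper (Sum.inr i))
    · exact Relation.EqvGen.refl _
  have hrβ : ∀ p, Relation.EqvGen (Strand D E) p (loStep E p) := by
    rintro (i | i | i)
    · exact Relation.EqvGen.refl _
    · exact Relation.EqvGen.rel _ _ (Strand.lower (Sum.inl i))
    · exact Relation.EqvGen.rel _ _ (Strand.lower (Sum.inr i))
  have hr : ∀ p q, Strand D E p q → q = p ∨ q = upStep D p ∨ q = loStep E p := by
    rintro _ _ (c | c)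
    · exact Or.inr (Or.inl (upStep_upper D c).symm)
    · exact Or.inr (Or.inr (loStep_lower E c).symm)
  have hfix : ∀ y, (upStep D y = y ∨ loStep E y = y) ↔ ∃ b, outer b = y := by
    rintro (i | i | i)
    · exact ⟨fun _ => ⟨Sum.inl i, rfl⟩, fun _ => Or.inr rfl⟩
    · constructor
      · rintro (h | h)
        · exact absurd h (hα1 (Sum.inr i))
        · exact absurd h (hβ1 (Sum.inl i))
      · rintro ⟨b | b, hb⟩ <;> simp [outer] at hb
    · exact ⟨fun _ => ⟨Sum.inr i, rfl⟩, fun _ => Or.inl rfl⟩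
  have key : ∃! y, (∃ b, outer b = y) ∧ y ≠ outer a ∧
      Relation.EqvGen (Strand D E) (outer a) y := by
    rcases a with i | i
    · simpa only [hfix] using partner_aux (upStep D) (loStep E) hα hβ (Strand D E) hrα hrβ hr
        (outer (Sum.inl i)) rfl (hα1 (Sum.inl i))
    · have hr' : ∀ p q, Strand D E p q → q = p ∨ q = loStep E p ∨ q = upStep D p :=
        fun p q h => (hr p q h).imp_right Or.symm
      have := partner_aux (loStep E) (upStep D) hβ hα (Strand D E) hrβ hrα hr'
        (outer (Sum.inr i)) rfl (hβ1 (Sum.inr i))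
      have hfix' (y) : (loStep E y = y ∨ upStep D y = y) ↔ ∃ b, outer b = y := by
        rw [or_comm, hfix]
      simpa only [hfix'] using this
  obtain ⟨y, ⟨⟨b, rfl⟩, h1, h2⟩, h3⟩ := key
  exact ⟨b, ⟨fun h => h1 (by rw [h]), h2⟩, fun c hc =>
    outer_inj (h3 _ ⟨⟨c, rfl⟩, fun h => hc.1 (outer_inj h), hc.2⟩)⟩

/-- The diagram obtained by stacking `D` on top of `E` and deleting the closed curves: it joins
each boundary point of the stack to the other boundary point of its component. -/
noncomputable def comp (D E : BrauerDiagram n) : BrauerDiagram n :=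
  ⟨fun a => (existsUnique_partner D E a).choose, by
    have spec (a) := (existsUnique_partner D E a).choose_spec
    refine ⟨fun a => ?_, fun a => (spec a).1.1⟩
    exact ((spec _).2 a ⟨(spec a).1.1.symm, (component D E).symm (spec a).1.2⟩).symm⟩

/-- The diagram of a permutation `s`, which joins the top point `i` to the bottom point `s i`. -/
def ofPerm (s : Equiv.Perm (Fin n)) : BrauerDiagram n :=
  ⟨Sum.elim (fun i => Sum.inr (s i)) (fun i => Sum.inl (s.symm i)), by
    constructor
    · rintro (i | i) <;> simp
    · rintro (i | i) <;> simp⟩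

/-- For `j ≠ k`, the diagram with strands joining `j` and `k` in the top row, `j` and `k` in the
bottom row, and vertical strands elsewhere. -/
def cupCap (j k : Fin n) (h : j ≠ k) : BrauerDiagram n :=
  ⟨Sum.elim
      (fun i => if i = j then Sum.inl k else if i = k then Sum.inl j else Sum.inr i)
      (fun i => if i = j then Sum.inr k else if i = k then Sum.inr j else Sum.inl i), by
    constructor
    · rintro (i | i) <;> by_cases h1 : i = j <;> by_cases h2 : i = k <;> simp_all
    · rintro (i | i) <;> by_cases h1 : i = j <;> by_cases h2 : i = k <;> simp_all [eq_comm]⟩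

/-- The number of through strands (strands from the top row to the bottom row). -/
def through (D : BrauerDiagram n) : ℕ :=
  #{i : Fin n | (D.1 (Sum.inl i)).isRight}

end BrauerDiagram

/-- The virtual Temperley-Lieb (Brauer) algebra with loop value `d`: formal linear combinations
of Brauer diagrams. -/
def VTL {K : Type*} [Field K] (n : ℕ) (_d : K) : Type _ := BrauerDiagram n →₀ K

namespace VTL

variable {K : Type*} [Field K] {n : ℕ} {d : K}

noncomputable instance : AddCommGroup (VTL n d) :=
  inferInstanceAs (AddCommGroup (BrauerDiagram n →₀ K))

noncomputable instance : Module K (VTL n d) :=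
  inferInstanceAs (Module K (BrauerDiagram n →₀ K))

/-- A diagram as an element of the algebra. -/
noncomputable def diag (d : K) (D : BrauerDiagram n) : VTL n d :=
  Finsupp.single D (1 : K)

/-- The bilinear extension of stacking, where every closed curve is replaced by a factor `d`. -/
noncomputable instance : Mul (VTL n d) where
  mul f g := Finsupp.sum f fun D a => Finsupp.sum g fun E b =>
    (a * b * d ^ BrauerDiagram.loops D E) • diag d (BrauerDiagram.comp D E)

noncomputable instance : One (VTL n d) where
  one := diag d (BrauerDiagram.ofPerm 1)

/-- The Temperley-Lieb generator `e_{i+1}` (points are numbered from `0`, so it joins the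
points `i` and `i + 1` of each row). -/
noncomputable def e (d : K) (i : ℕ) (h : i + 1 < n) : VTL n d :=
  diag d (BrauerDiagram.cupCap ⟨i, Nat.lt_of_succ_lt h⟩ ⟨i + 1, h⟩ (by simp))

/-- The virtual generator `v_{i+1}` (points are numbered from `0`, so it crosses the strands
at the points `i` and `i + 1`). -/
noncomputable def v (d : K) (i : ℕ) (h : i + 1 < n) : VTL n d :=
  diag d (BrauerDiagram.ofPerm (Equiv.swap ⟨i, Nat.lt_of_succ_lt h⟩ ⟨i + 1, h⟩))

/-- `x_i = 1 / (i + 1)`. -/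
def x (K : Type*) [Field K] (i : ℕ) : K := 1 / ((i : K) + 1)

/-- `y_i = - 2 i / ((i + 1) (d + 2 i - 2))`. -/
def y (d : K) (i : ℕ) : K := -(2 * (i : K)) / (((i : K) + 1) * (d + 2 * (i : K) - 2))

/-- `z_i = i / (i + 1)`. -/
def z (K : Type*) [Field K] (i : ℕ) : K := (i : K) / ((i : K) + 1)

/-- The elements `f_i` of the algebra on `n` strands, for `1 ≤ i ≤ n`: `f_1 = 1` and
`f_i = x_{i-1} f_{i-1} + y_{i-1} f_{i-1} e_{i-1} f_{i-1} + z_{i-1} f_{i-1} v_{i-1} f_{i-1}`.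
(The value at `i = 0` is not used.) -/
noncomputable def f (n : ℕ) (d : K) : (i : ℕ) → i ≤ n → VTL n d
  | 0, _ => 1
  | 1, _ => 1
  | i + 2, h =>
    x K (i + 1) • f n d (i + 1) (Nat.le_of_succ_le h)
      + y d (i + 1) •
        (f n d (i + 1) (Nat.le_of_succ_le h) * e d i h * f n d (i + 1) (Nat.le_of_succ_le h))
      + z K (i + 1) •
        (f n d (i + 1) (Nat.le_of_succ_le h) * v d i h * f n d (i + 1) (Nat.le_of_succ_le h))

/-- `[k]_n`, the sum of all Brauer diagrams on `n` strands with exactly `k` through strands. -/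
noncomputable def throughSum (n : ℕ) (d : K) (k : ℕ) : VTL n d :=
  ∑ D : BrauerDiagram n with D.through = k, diag d D

end VTL

/-!
Let `S_m` be the right-hand side of the formula for `m` strands, placed on the first `m` of `n`
strands. Two facts show that `S_m` satisfies the recursion that defines `f_m`.

* `S_m` absorbs the permutations of the first `m` points, and it is killed by every diagram with a
  cap among them: the diagrams that a cup-cap `U` turns into a given multiple of `G` arise from `G`
  by exchanging one end of the cap of `G` with another boundary point, and the weights of `S_m` are
  such that these contributions cancel. Hence `S_m S_k = S_k` for `m ≤ k`.
* Therefore `S_{m+1} = S_m S_{m+1} S_m`, and in this sandwich only the diagrams without cap and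
  without cup among the first `m` points survive. These are the permutations of `m + 1` points and
  their images under the exchange of the two boundary points in the last column; between two copies
  of `S_m` each of them becomes `S_m`, `S_m v S_m` or `S_m e S_m`.

All identities between stacked diagrams are reduced to matrix identities. Colouring the boundary
points with two colours represents a diagram by a zero-one matrix, with `2` as the value of a
closed curve, and a power of `2` times such a matrix determines both the exponent and the diagram.
Equalities of matrices over `ℕ` therefore yield the stacked diagram and the number of closed curves.
-/

theorem card_functions_extending {A Q C : Type*} [Finite Q] {o : A → Q} {c : A → C}
    (hc : c.FactorsThrough o) :
    Nat.card {g : Q → C // ∀ a, g (o a) = c a} = Nat.card C ^ Nat.card {q // ∀ a, o a ≠ q} := by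
  classical
  let c' : {q // ∃ a, o a = q} → C := fun q => c q.2.choose
  have hc' (a : A) : c' ⟨o a, a, rfl⟩ = c a :=
    hc (Exists.choose_spec (p := fun b => o b = o a) _)
  have extends_iff (g : Q → C) : (∀ a, g (o a) = c a) ↔ g ∘ Subtype.val = c' :=
    ⟨fun hg => by ext ⟨_, a, rfl⟩; exact (hg a).trans (hc' a).symm,
      fun hg a => (congrFun hg ⟨o a, a, rfl⟩).trans (hc' a)⟩
  rw [Nat.card_congr ((Equiv.subtypeEquivRight extends_iff).trans (Equiv.subtypePreimage _ c')),
    Nat.card_fun, Nat.card_congr (Equiv.subtypeEquivRight fun q => not_exists)]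

theorem even_card_of_involution {α : Type*} {s : Finset α} {g : α → α}
    (mem : ∀ a ∈ s, g a ∈ s) (ne : ∀ a ∈ s, g a ≠ a) (invol : ∀ a ∈ s, g (g a) = a) :
    Even #s := by
  have : ∑ _a ∈ s, (1 : ZMod 2) = 0 :=
    sum_involution (fun a _ => g a) (fun _ _ => by decide) (fun a ha _ => ne a ha) mem invol
  rwa [sum_const, nsmul_one, ZMod.natCast_eq_zero_iff_even] at this

theorem card_filter_sum {α β : Type*} [Fintype α] [Fintype β] (P : α ⊕ β → Prop)
    [DecidablePred P] :
    #{p : α ⊕ β | P p} = #{a : α | P (Sum.inl a)} + #{b : β | P (Sum.inr b)} := by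
  simp only [card_filter, Fintype.sum_sum_type]

theorem swap_apply_conj_of_involutive {α : Type*} [DecidableEq α] {g : α → α}
    (hg : Function.Involutive g) (ne : ∀ x, g x ≠ x) (a p x : α) :
    Equiv.swap (g a) p (g (Equiv.swap (g a) p x)) =
      Equiv.swap a (g p) (g (Equiv.swap a (g p) x)) := by
  have hgg (x) : g (g x) = x := hg x
  simp only [Equiv.swap_apply_def]
  grind

namespace BrauerDiagram

variable {n : ℕ} {D E G : BrauerDiagram n}

theorem comp_spec (D E : BrauerDiagram n) (a : Fin n ⊕ Fin n) :
    component D E (outer a) (outer ((comp D E).1 a)) :=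
  (existsUnique_partner D E a).choose_spec.1.2

theorem eq_or_eq_comp_of_component {a b : Fin n ⊕ Fin n}
    (h : component D E (outer a) (outer b)) : b = a ∨ b = (comp D E).1 a :=
  or_iff_not_imp_left.2 fun hb => (existsUnique_partner D E a).choose_spec.2 b ⟨hb, h⟩

/-- A colouring of the boundary points in two colours is compatible with a diagram if every
strand has both ends of the same colour. -/
abbrev Compat (D : BrauerDiagram n) (c : Fin n ⊕ Fin n → Bool) : Prop := ∀ a, c (D.1 a) = c a

/-- The colouring of the points of a stack with prescribed colours in the top, middle and
bottom row. -/
def stackColour (t m b : Fin n → Bool) : Stack n → Bool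
  | Stack.top i => t i
  | Stack.mid i => m i
  | Stack.bot i => b i

section StackColour

variable (t m b : Fin n → Bool)

theorem stackColour_comp_upper : stackColour t m b ∘ upper = Sum.elim t m := by
  ext (i | i) <;> rfl

theorem stackColour_comp_lower : stackColour t m b ∘ lower = Sum.elim m b := by
  ext (i | i) <;> rfl

theorem stackColour_comp_outer : stackColour t m b ∘ outer = Sum.elim t b := by
  ext (i | i) <;> rfl

theorem eq_stackColour {t b : Fin n → Bool} {s : Stack n → Bool}
    (hs : ∀ a, s (outer a) = Sum.elim t b a) : s = stackColour t (s ∘ Stack.mid) b := by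
  ext (i | i | i)
  · exact hs (Sum.inl i)
  · rfl
  · exact hs (Sum.inr i)

theorem component_le_ker_iff {s : Stack n → Bool} :
    component D E ≤ Setoid.ker s ↔ Compat D (s ∘ upper) ∧ Compat E (s ∘ lower) := by
  refine ⟨fun h => ⟨fun a => (h (.rel _ _ (Strand.upper a))).symm,
    fun a => (h (.rel _ _ (Strand.lower a))).symm⟩, fun h => Setoid.eqvGen_le ?_⟩
  rintro _ _ (a | a)
  · exact (h.1 a).symm
  · exact (h.2 a).symm

/-- Compatible colourings of the middle row of a stack, for given colours of the top and bottom
row, correspond to the colourings of the components that induce the given colours. -/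
def midColouringEquiv (D E : BrauerDiagram n) (t b : Fin n → Bool) :
    {m : Fin n → Bool // Compat D (Sum.elim t m) ∧ Compat E (Sum.elim m b)} ≃
    {g : Quotient (component D E) → Bool // ∀ a, g ⟦outer a⟧ = Sum.elim t b a} where
  toFun m := ⟨Quotient.lift (stackColour t m b)
      fun _ _ h => component_le_ker_iff.2
        (by rw [stackColour_comp_upper, stackColour_comp_lower]; exact m.2) h,
    congrFun (stackColour_comp_outer t m b)⟩
  invFun g := ⟨fun i => g.1 ⟦Stack.mid i⟧, by
    have hg : component D E ≤ Setoid.ker (g.1 ∘ Quotient.mk _) :=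
      fun p q h => congrArg g.1 (Quotient.sound h)
    rw [eq_stackColour (s := g.1 ∘ Quotient.mk _) g.2, component_le_ker_iff,
      stackColour_comp_upper, stackColour_comp_lower] at hg
    exact hg⟩
  left_inv m := rfl
  right_inv g := by
    ext q
    induction q using Quotient.inductionOn with
    | h p => exact (congrFun (eq_stackColour (s := g.1 ∘ Quotient.mk _) g.2) p).symm

end StackColour

theorem card_midColouring (D E : BrauerDiagram n) (t b : Fin n → Bool) :
    #{m : Fin n → Bool | Compat D (Sum.elim t m) ∧ Compat E (Sum.elim m b)} =
      if Compat (comp D E) (Sum.elim t b) then 2 ^ loops D E else 0 := by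
  rw [← Fintype.card_subtype, ← Nat.card_eq_fintype_card,
    Nat.card_congr (midColouringEquiv D E t b)]
  split_ifs with h
  · have hc : (Sum.elim t b).FactorsThrough (fun a => (⟦outer a⟧ : Quotient (component D E))) := by
      intro a a' haa'
      rcases eq_or_eq_comp_of_component (Quotient.exact haa') with rfl | rfl
      · rfl
      · exact (h a).symm
    rw [card_functions_extending hc, Nat.card_eq_fintype_card, Fintype.card_bool, loops]
  · refine Nat.card_eq_zero.2 (Or.inl ⟨fun g => h fun a => ?_⟩)
    rw [← g.2, ← g.2, Quotient.sound (comp_spec D E a)]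

/-- The matrix indexed by the colourings of the top and of the bottom row that records which
colourings are compatible with the diagram. It is the action of the diagram on the `n`-th tensor
power of a two-dimensional space, for loop value `2`. -/
def colourMatrix (D : BrauerDiagram n) : Matrix (Fin n → Bool) (Fin n → Bool) ℕ :=
  Matrix.of fun t b => if Compat D (Sum.elim t b) then 1 else 0

theorem colourMatrix_apply (D : BrauerDiagram n) (t b : Fin n → Bool) :
    colourMatrix D t b = if Compat D (Sum.elim t b) then 1 else 0 := rfl

theorem colourMatrix_mul (D E : BrauerDiagram n) :
    colourMatrix D * colourMatrix E = 2 ^ loops D E • colourMatrix (comp D E) := by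
  ext t b
  simp only [Matrix.mul_apply, Matrix.smul_apply, colourMatrix_apply, smul_eq_mul, mul_ite, mul_one,
    mul_zero, ← card_midColouring, card_filter, ite_and]
  exact sum_congr rfl fun m _ => by split_ifs <;> rfl

theorem colourMatrix_injective : Function.Injective (colourMatrix (n := n)) := by
  intro D E h
  have compat_iff (c) : Compat D c ↔ Compat E c := by
    have := congrFun (congrFun h (c ∘ Sum.inl)) (c ∘ Sum.inr)
    simp only [colourMatrix_apply, Sum.elim_comp_inl_inr] at this
    by_contra hne
    split_ifs at this <;> tauto
  ext1
  funext a
  -- Besides `D`, only the diagrams that join `a` to `D.1 a` are compatible with this colouring.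
  let c : Fin n ⊕ Fin n → Bool := fun p => decide (p = a ∨ p = D.1 a)
  have hD : Compat D c := fun p =>
    decide_eq_decide.2 (by rw [D.2.1.eq_iff, D.2.1.injective.eq_iff, or_comm])
  have hE : c (E.1 a) = c a := (compat_iff c).1 hD a
  simp only [c, true_or, decide_true, decide_eq_true_eq] at hE
  exact (hE.resolve_left (E.2.2 a)).symm

theorem colourMatrix_const (D : BrauerDiagram n) :
    colourMatrix D (fun _ => true) (fun _ => true) = 1 := by
  have : (Sum.elim (fun _ => true) fun _ => true : Fin n ⊕ Fin n → Bool) = fun _ => true := by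
    ext (i | i) <;> rfl
  rw [colourMatrix_apply, this, if_pos fun _ => rfl]

theorem eq_of_pow_smul_colourMatrix {k l : ℕ}
    (h : 2 ^ k • colourMatrix D = 2 ^ l • colourMatrix E) : D = E ∧ k = l := by
  have hkl : k = l := by
    have := congrFun (congrFun h fun _ => true) fun _ => true
    simpa only [Matrix.smul_apply, colourMatrix_const, smul_eq_mul, mul_one,
      Nat.pow_right_inj (le_refl 2)] using this
  subst hkl
  exact ⟨colourMatrix_injective (smul_right_injective _ (pow_ne_zero k two_ne_zero) h), rfl⟩

theorem comp_eq_and_loops_eq {k : ℕ}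
    (h : colourMatrix D * colourMatrix E = 2 ^ k • colourMatrix G) :
    comp D E = G ∧ loops D E = k :=
  eq_of_pow_smul_colourMatrix ((colourMatrix_mul D E).symm.trans h)

theorem comp_assoc_and_loops_add_loops (D E G : BrauerDiagram n) :
    comp (comp D E) G = comp D (comp E G) ∧
      loops D E + loops (comp D E) G = loops E G + loops D (comp E G) := by
  apply eq_of_pow_smul_colourMatrix
  simpa only [colourMatrix_mul, Matrix.smul_mul, Matrix.mul_smul, smul_smul, ← pow_add] using
    Matrix.mul_assoc (colourMatrix D) (colourMatrix E) (colourMatrix G)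

/-- The diagram whose boundary points are renamed by a permutation `σ`. -/
def relabel (σ : Equiv.Perm (Fin n ⊕ Fin n)) : Equiv.Perm (BrauerDiagram n) where
  toFun D := ⟨fun a => σ (D.1 (σ.symm a)), fun a => by simp [D.2.1 _],
    fun a h => D.2.2 (σ.symm a) (σ.eq_symm_apply.2 h)⟩
  invFun D := ⟨fun a => σ.symm (D.1 (σ a)), fun a => by simp [D.2.1 _],
    fun a h => D.2.2 (σ a) (σ.symm_apply_eq.1 h)⟩
  left_inv D := by ext; simp
  right_inv D := by ext; simp

theorem relabel_apply (σ : Equiv.Perm (Fin n ⊕ Fin n)) (D : BrauerDiagram n)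
    (a : Fin n ⊕ Fin n) : (relabel σ D).1 a = σ (D.1 (σ.symm a)) := rfl

theorem compat_relabel_iff (σ : Equiv.Perm (Fin n ⊕ Fin n)) (D : BrauerDiagram n)
    (c : Fin n ⊕ Fin n → Bool) : Compat (relabel σ D) c ↔ Compat D (c ∘ σ) :=
  ⟨fun h a => by simpa [relabel_apply] using h (σ a),
    fun h a => by simpa [relabel_apply] using h (σ.symm a)⟩

/-- The diagram turned upside down. -/
abbrev mirror : Equiv.Perm (BrauerDiagram n) := relabel (Equiv.sumComm _ _)

theorem mirror_mirror (D : BrauerDiagram n) : mirror (mirror D) = D := by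
  ext; simp [relabel_apply]

theorem colourMatrix_mirror (D : BrauerDiagram n) :
    colourMatrix (mirror D) = (colourMatrix D).transpose := by
  ext t b
  have : Sum.elim t b ∘ Equiv.sumComm (Fin n) (Fin n) = Sum.elim b t := by
    ext (i | i) <;> rfl
  simp only [Matrix.transpose_apply, colourMatrix_apply, compat_relabel_iff, this]

theorem mirror_ofPerm (s : Equiv.Perm (Fin n)) : mirror (ofPerm s) = ofPerm s⁻¹ := by
  ext (i | i) <;> rfl

theorem mirror_cupCap (i j : Fin n) (h : i ≠ j) : mirror (cupCap i j h) = cupCap i j h := by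
  ext (k | k) <;> simp only [relabel_apply, cupCap, Equiv.sumComm_apply, Equiv.sumComm_symm,
    Sum.swap_inl, Sum.swap_inr, Sum.elim_inl, Sum.elim_inr] <;> split_ifs <;> rfl

theorem compat_ofPerm_iff (s : Equiv.Perm (Fin n)) (t m : Fin n → Bool) :
    Compat (ofPerm s) (Sum.elim t m) ↔ m = t ∘ s.symm := by
  refine ⟨fun h => funext fun i => (h (Sum.inr i)).symm, ?_⟩
  rintro rfl (i | i) <;> simp [ofPerm]

theorem colourMatrix_ofPerm_mul (s : Equiv.Perm (Fin n)) (D : BrauerDiagram n) :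
    colourMatrix (ofPerm s) * colourMatrix D = colourMatrix (relabel (Equiv.sumCongr s⁻¹ 1) D) := by
  ext t b
  have : Sum.elim t b ∘ Equiv.sumCongr s⁻¹ (1 : Equiv.Perm (Fin n)) =
      Sum.elim (t ∘ s.symm) b := by
    ext (i | i) <;> rfl
  simp only [Matrix.mul_apply, colourMatrix_apply, compat_ofPerm_iff, ite_mul, one_mul, zero_mul,
    sum_ite_eq', mem_univ, if_true, compat_relabel_iff, this]

theorem compat_cupCap_iff {i j : Fin n} (h : i ≠ j) (t m : Fin n → Bool) :
    Compat (cupCap i j h) (Sum.elim t m) ↔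
      t i = t j ∧ ∃ x, (fun k => if k = i ∨ k = j then x else t k) = m := by
  constructor
  · refine fun hc => ⟨?_, m i, ?_⟩
    · simpa [cupCap, eq_comm] using hc (Sum.inl i)
    · funext k
      have hi := hc (Sum.inr i)
      have hk := hc (Sum.inr k)
      simp only [cupCap, Sum.elim_inr] at hi hk
      grind
  · rintro ⟨ht, x, rfl⟩ (k | k) <;> simp only [cupCap, Sum.elim_inl, Sum.elim_inr] <;> grind

theorem colourMatrix_cupCap_mul_apply {i j : Fin n} (h : i ≠ j)
    (N : Matrix (Fin n → Bool) (Fin n → Bool) ℕ) (t b : Fin n → Bool) :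
    (colourMatrix (cupCap i j h) * N) t b =
      if t i = t j then ∑ x, N (fun k => if k = i ∨ k = j then x else t k) b else 0 := by
  set φ : Bool → Fin n → Bool := fun x k => if k = i ∨ k = j then x else t k with hφ
  have hφ_inj : φ.Injective := fun x y hxy => by simpa [hφ] using congrFun hxy i
  simp only [Matrix.mul_apply, colourMatrix_apply, compat_cupCap_iff, ite_mul, one_mul, zero_mul]
  split_ifs with ht
  · simp only [ht, true_and, ← sum_filter]
    rw [← sum_image (g := φ) (f := (N · b)) hφ_inj.injOn]
    exact sum_congr (by ext m; simp only [mem_filter, mem_univ, true_and, mem_image]; rfl)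
      fun _ _ => rfl
  · simp only [ht, false_and, if_false, sum_const_zero]

theorem compat_relabel_swap_iff {a p q : Fin n ⊕ Fin n} (hG : G.1 a = p) (hq : q ≠ a)
    (c : Fin n ⊕ Fin n → Bool) (x : Bool) :
    (c a = c p ∧ Compat (relabel (Equiv.swap p q) G) fun r => if r = a ∨ r = p then x else c r) ↔
      Compat G c ∧ (q = p ∨ x = c q) := by
  have hp : G.1 p = a := by rw [← hG, G.2.1]
  have : a ≠ p := hG ▸ (G.2.2 a).symm
  have hinv := G.2.1
  have recoloured : ((fun r => if r = a ∨ r = p then x else c r) ∘ Equiv.swap p q) =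
      fun r => if r = a ∨ r = q then x else if r = p then c q else c r := by
    funext r
    grind
  rw [compat_relabel_iff, recoloured]
  constructor
  · rintro ⟨hc, hG'⟩
    have hx : q = p ∨ x = c q := by grind
    refine ⟨fun r => ?_, hx⟩
    have := hG' r
    have := hinv r
    grind
  · rintro ⟨hc, hx⟩
    refine ⟨by grind, fun r => ?_⟩
    have := hc r
    have := hinv r
    grind

theorem colourMatrix_cupCap_mul {i j : Fin n} (h : i ≠ j) (hG : G.1 (Sum.inl i) = Sum.inl j)
    {p : Fin n ⊕ Fin n} (hp : p ≠ Sum.inl i) :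
    colourMatrix (cupCap i j h) * colourMatrix (relabel (Equiv.swap (Sum.inl j) p) G) =
      2 ^ (if p = Sum.inl j then 1 else 0) • colourMatrix G := by
  ext t b
  have recoloured (x : Bool) : Sum.elim (fun k => if k = i ∨ k = j then x else t k) b =
      fun r => if r = Sum.inl i ∨ r = Sum.inl j then x else Sum.elim t b r := by
    ext (k | k) <;> simp
  have compat_iff := compat_relabel_swap_iff hG hp (Sum.elim t b)
  simp only [Sum.elim_inl] at compat_iff
  calc _ = ∑ x, if Compat G (Sum.elim t b) ∧ (p = Sum.inl j ∨ x = Sum.elim t b p)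
          then 1 else 0 := by
        simp only [colourMatrix_cupCap_mul_apply, colourMatrix_apply, recoloured, ← compat_iff,
          ite_and, sum_ite_irrel, sum_const_zero]
    _ = _ := by
        rw [Matrix.smul_apply, colourMatrix_apply]
        by_cases hpj : p = Sum.inl j
        · simp [hpj]
        · simp [hpj, ite_and]

theorem colourMatrix_ofPerm_one : colourMatrix (ofPerm (1 : Equiv.Perm (Fin n))) = 1 := by
  ext t b
  simp only [colourMatrix_apply, compat_ofPerm_iff, Matrix.one_apply, eq_comm (a := b)]
  rfl

/-! ### Diagrams on the first `m` strands -/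

variable {m : ℕ}

/-- The number of caps, the strands that join two top points. -/
def caps (D : BrauerDiagram n) : ℕ :=
  #{p : Fin n ⊕ Fin n | p.isLeft ∧ (D.1 p).isLeft} / 2

theorem two_mul_caps (D : BrauerDiagram n) :
    2 * D.caps = #{p : Fin n ⊕ Fin n | p.isLeft ∧ (D.1 p).isLeft} := by
  refine Nat.two_mul_div_two_of_even (even_card_of_involution (g := D.1) (fun p hp => ?_)
    (fun p _ => D.2.2 p) (fun p _ => D.2.1 p))
  simpa only [mem_filter, mem_univ, true_and, D.2.1 p, and_comm] using hp

theorem through_add_two_mul_caps (D : BrauerDiagram n) : D.through + 2 * D.caps = n := by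
  rw [two_mul_caps, card_filter_sum]
  simpa [through] using card_filter_add_card_filter_not (s := (univ : Finset (Fin n)))
    (fun i => (D.1 (Sum.inl i)).isRight = true)

theorem card_isRight_and_isRight (D : BrauerDiagram n) :
    #{p : Fin n ⊕ Fin n | p.isRight ∧ (D.1 p).isRight} = 2 * D.caps := by
  have through_eq : #{p : Fin n ⊕ Fin n | p.isRight ∧ (D.1 p).isLeft} = D.through := by
    rw [card_equiv D.2.1.toPerm (t := {p : Fin n ⊕ Fin n | p.isLeft ∧ (D.1 p).isRight})
      fun p => by simp [D.2.1 p, and_comm], card_filter_sum]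
    simp [through]
  have total := card_filter_add_card_filter_not
    (s := ({p : Fin n ⊕ Fin n | p.isRight} : Finset _)) (fun p => (D.1 p).isLeft = true)
  simp only [filter_filter, Sum.not_isLeft, through_eq] at total
  rw [card_filter_sum (fun p : Fin n ⊕ Fin n => p.isRight = true)] at total
  simp only [Sum.isRight_inl, Sum.isRight_inr, Bool.false_eq_true, filter_false, card_empty,
    filter_true, card_univ, Fintype.card_fin, zero_add] at total
  have := D.through_add_two_mul_caps
  omega

theorem two_mul_caps_relabel (σ : Equiv.Perm (Fin n ⊕ Fin n)) (D : BrauerDiagram n) :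
    2 * (relabel σ D).caps = #{p : Fin n ⊕ Fin n | (σ p).isLeft ∧ (σ (D.1 p)).isLeft} := by
  rw [two_mul_caps]
  refine card_equiv σ.symm fun p => ?_
  rw [mem_filter_univ, mem_filter_univ, relabel_apply, Equiv.apply_symm_apply]

theorem caps_mirror (D : BrauerDiagram n) : (mirror D).caps = D.caps := by
  have := two_mul_caps_relabel (Equiv.sumComm _ _) D
  simp only [Equiv.sumComm_apply, Sum.isLeft_swap] at this
  exact Nat.eq_of_mul_eq_mul_left two_pos (this.trans D.card_isRight_and_isRight)

theorem caps_relabel_sumCongr (s t : Equiv.Perm (Fin n)) (D : BrauerDiagram n) :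
    (relabel (Equiv.sumCongr s t) D).caps = D.caps := by
  have := two_mul_caps_relabel (Equiv.sumCongr s t) D
  simp only [Equiv.sumCongr_apply, Sum.isLeft_map, ← two_mul_caps] at this
  omega

theorem caps_ofPerm (s : Equiv.Perm (Fin n)) : (ofPerm s).caps = 0 := by
  have := two_mul_caps (ofPerm s)
  rw [card_filter_sum] at this
  simpa [ofPerm] using this

theorem relabel_swap_apply_eq (D : BrauerDiagram n) (a p : Fin n ⊕ Fin n) :
    relabel (Equiv.swap (D.1 a) p) D = relabel (Equiv.swap a (D.1 p)) D := by
  refine Subtype.ext (funext fun r => ?_)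
  simp only [relabel_apply, Equiv.symm_swap]
  exact swap_apply_conj_of_involutive D.2.1 D.2.2 a p r

theorem caps_pos {i : Fin n} (hi : (D.1 (Sum.inl i)).isLeft) : 0 < D.caps := by
  have : 0 < 2 * D.caps := by
    rw [two_mul_caps]
    exact card_pos.2 ⟨Sum.inl i, (mem_filter_univ _).2 ⟨rfl, hi⟩⟩
  omega

theorem caps_relabel_swap_inl_inr {i j k l : Fin n} (hij : D.1 (Sum.inl i) = Sum.inl j)
    (hkl : D.1 (Sum.inr k) = Sum.inr l) :
    (relabel (Equiv.swap (Sum.inl j) (Sum.inr k)) D).caps + 1 = D.caps := by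
  have hij' : i ≠ j := fun h => D.2.2 (Sum.inl i) (by rw [hij, h])
  have hji : D.1 (Sum.inl j) = Sum.inl i := by rw [← hij, D.2.1]
  have lost : ({Sum.inl i, Sum.inl j} : Finset (Fin n ⊕ Fin n)) ⊆
      ({p | p.isLeft ∧ (D.1 p).isLeft} : Finset (Fin n ⊕ Fin n)) := by
    simp [insert_subset_iff, hij, hji]
  have remaining : ({p | (Equiv.swap (Sum.inl j) (Sum.inr k) p).isLeft ∧
      (Equiv.swap (Sum.inl j) (Sum.inr k) (D.1 p)).isLeft} : Finset (Fin n ⊕ Fin n)) =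
      ({p | p.isLeft ∧ (D.1 p).isLeft} : Finset (Fin n ⊕ Fin n)) \ {Sum.inl i, Sum.inl j} := by
    ext p
    have := D.2.1 p
    simp only [mem_filter, mem_univ, true_and, mem_sdiff, mem_insert, mem_singleton,
      Equiv.swap_apply_def]
    grind
  have hcard := card_sdiff_add_card_eq_card lost
  rw [card_pair (by simpa using hij'), ← remaining, ← two_mul_caps_relabel, ← two_mul_caps] at hcard
  omega

theorem caps_relabel_swap {i j : Fin n} (hij : D.1 (Sum.inl i) = Sum.inl j)
    (p : Fin n ⊕ Fin n) :
    (relabel (Equiv.swap (Sum.inl j) p) D).caps =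
      if p.isRight ∧ (D.1 p).isRight then D.caps - 1 else D.caps := by
  rcases p with k | k
  · rw [if_neg (by simp), ← Equiv.Perm.sumCongr_swap_one]
    exact caps_relabel_sumCongr _ _ _
  rcases hkl : D.1 (Sum.inr k) with l | l
  · rw [if_neg (by simp), ← hij, relabel_swap_apply_eq, hkl, ← Equiv.Perm.sumCongr_swap_one]
    exact caps_relabel_sumCongr _ _ _
  · rw [if_pos (by simp), ← caps_relabel_swap_inl_inr hij hkl, Nat.add_sub_cancel]

/-- The column of a boundary point, numbered from `0`. -/
def column : Fin n ⊕ Fin n → ℕ := Sum.elim Fin.val Fin.val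

/-- The diagrams with vertical strands in all columns from `m` on, that is, the diagrams on the
first `m` strands. -/
def verticalFrom (n m : ℕ) : Finset (BrauerDiagram n) :=
  {D | ∀ i : Fin n, m ≤ i → D.1 (Sum.inl i) = Sum.inr i}

theorem mem_verticalFrom : D ∈ verticalFrom n m ↔
    ∀ i : Fin n, m ≤ i → D.1 (Sum.inl i) = Sum.inr i := by
  simp only [verticalFrom, mem_filter, mem_univ, true_and]

theorem apply_inr_of_mem_verticalFrom (hD : D ∈ verticalFrom n m) {i : Fin n} (hi : m ≤ i) :
    D.1 (Sum.inr i) = Sum.inl i := by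
  rw [← mem_verticalFrom.1 hD i hi, D.2.1]

theorem column_apply_lt (hD : D ∈ verticalFrom n m) {a : Fin n ⊕ Fin n} (ha : column a < m) :
    column (D.1 a) < m := by
  have hup := mem_verticalFrom.1 hD
  have hdown (i : Fin n) (hi : m ≤ i) := apply_inr_of_mem_verticalFrom hD hi
  have := D.2.1 a
  rcases a with i | i <;> rcases h : D.1 _ with k | k <;> simp only [column, Sum.elim_inl,
    Sum.elim_inr] at ha ⊢ <;> grind

theorem column_lt_of_isLeft (hD : D ∈ verticalFrom n m) {i : Fin n}
    (hi : (D.1 (Sum.inl i)).isLeft) : i < m := by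
  by_contra! hmi
  simp [mem_verticalFrom.1 hD i hmi] at hi

theorem column_lt_of_isRight (hD : D ∈ verticalFrom n m) {i : Fin n}
    (hi : (D.1 (Sum.inr i)).isRight) : i < m := by
  by_contra! hmi
  simp [apply_inr_of_mem_verticalFrom hD hmi] at hi

theorem two_mul_caps_le (hD : D ∈ verticalFrom n m) : 2 * D.caps ≤ m := by
  rw [two_mul_caps, card_filter_sum]
  simp only [Sum.isLeft_inl, Sum.isLeft_inr, true_and, Bool.false_eq_true, false_and, filter_false,
    card_empty, add_zero]
  calc _ ≤ #{i : Fin n | i < m} := card_le_card (monotone_filter_right _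
        fun _ _ hi => column_lt_of_isLeft hD hi)
    _ ≤ m := by rw [Fin.card_filter_val_lt]; exact min_le_right n m

theorem relabel_mem_verticalFrom {σ : Equiv.Perm (Fin n ⊕ Fin n)}
    (hσ : ∀ a, m ≤ column a → σ a = a) (hD : D ∈ verticalFrom n m) :
    relabel σ D ∈ verticalFrom n m := by
  refine mem_verticalFrom.2 fun i hi => ?_
  rw [relabel_apply, σ.symm_apply_eq.2 (hσ (Sum.inl i) hi).symm, mem_verticalFrom.1 hD i hi,
    hσ (Sum.inr i) hi]

theorem relabel_mem_verticalFrom_iff {σ : Equiv.Perm (Fin n ⊕ Fin n)}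
    (hσ : ∀ a, m ≤ column a → σ a = a) :
    relabel σ D ∈ verticalFrom n m ↔ D ∈ verticalFrom n m := by
  refine ⟨fun h => ?_, relabel_mem_verticalFrom hσ⟩
  have := relabel_mem_verticalFrom (σ := σ.symm) (fun a ha => σ.symm_apply_eq.2 (hσ a ha).symm) h
  exact (relabel σ).symm_apply_apply D ▸ this

theorem mirror_mem_verticalFrom (hD : D ∈ verticalFrom n m) : mirror D ∈ verticalFrom n m :=
  mem_verticalFrom.2 fun _ hi => congrArg Sum.swap (apply_inr_of_mem_verticalFrom hD hi)

theorem swap_apply_of_column_lt {a b : Fin n ⊕ Fin n} (ha : column a < m) (hb : column b < m)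
    (p : Fin n ⊕ Fin n) (hp : m ≤ column p) : Equiv.swap a b p = p :=
  Equiv.swap_apply_of_ne_of_ne (by rintro rfl; omega) (by rintro rfl; omega)

/-- The permutations of the first `m` points. -/
def permsBelow (n m : ℕ) : Finset (Equiv.Perm (Fin n)) := {s | ∀ i : Fin n, m ≤ i → s i = i}

theorem mem_permsBelow {s : Equiv.Perm (Fin n)} :
    s ∈ permsBelow n m ↔ ∀ i : Fin n, m ≤ i → s i = i := by
  simp only [permsBelow, mem_filter, mem_univ, true_and]

theorem permsBelow_mono {k : ℕ} (h : m ≤ k) : permsBelow n m ⊆ permsBelow n k :=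
  fun _ hs => mem_permsBelow.2 fun i hi => mem_permsBelow.1 hs i (h.trans hi)

theorem inv_mem_permsBelow {s : Equiv.Perm (Fin n)} (hs : s ∈ permsBelow n m) :
    s⁻¹ ∈ permsBelow n m :=
  mem_permsBelow.2 fun i hi => Equiv.Perm.inv_eq_iff_eq.2 (mem_permsBelow.1 hs i hi).symm

theorem card_permsBelow (hm : m ≤ n) : #(permsBelow n m) = m.factorial := by
  simp only [permsBelow, ← not_lt]
  rw [← Fintype.card_subtype,
    ← Fintype.card_congr (Equiv.Perm.subtypeEquivSubtypePerm fun a : Fin n => a.1 < m),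
    Fintype.card_perm, Fintype.card_subtype, Fin.card_filter_val_lt, min_eq_right hm]

theorem sumCongr_apply_of_mem_permsBelow {s t : Equiv.Perm (Fin n)} (hs : s ∈ permsBelow n m)
    (ht : t ∈ permsBelow n m) (a : Fin n ⊕ Fin n) (ha : m ≤ column a) :
    Equiv.sumCongr s t a = a := by
  rcases a with i | i
  · exact congrArg Sum.inl (mem_permsBelow.1 hs i ha)
  · exact congrArg Sum.inr (mem_permsBelow.1 ht i ha)

theorem ofPerm_injective : Function.Injective (ofPerm (n := n)) := fun s t h => by
  ext1 i
  exact Sum.inr_injective (congrFun (congrArg Subtype.val h) (Sum.inl i))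

theorem ofPerm_mem_verticalFrom_iff {s : Equiv.Perm (Fin n)} :
    ofPerm s ∈ verticalFrom n m ↔ s ∈ permsBelow n m := by
  simp [mem_verticalFrom, mem_permsBelow, ofPerm]

theorem exists_eq_ofPerm (h : ∀ i, (D.1 (Sum.inl i)).isRight) :
    ∃ s : Equiv.Perm (Fin n), D = ofPerm s := by
  choose g hg using fun i => Sum.isRight_iff.1 (h i)
  have hg_inj : Function.Injective g := fun i j hij =>
    Sum.inl_injective (D.2.1.injective (by rw [hg, hg, hij]))
  let s : Equiv.Perm (Fin n) := Equiv.ofBijective g (Finite.injective_iff_bijective.1 hg_inj)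
  have hs (i : Fin n) : D.1 (Sum.inl i) = Sum.inr (s i) := hg i
  refine ⟨s, Subtype.ext (funext ?_)⟩
  rintro (i | i)
  · exact hs i
  · obtain ⟨k, rfl⟩ := s.surjective i
    rw [← hs, D.2.1, hs]
    simp [ofPerm]

/-- Some strand joins two of the first `m` top points. -/
def HasCap (m : ℕ) (D : BrauerDiagram n) : Prop :=
  ∃ p q : Fin n, p < m ∧ q < m ∧ D.1 (Sum.inl p) = Sum.inl q

theorem HasCap.mono {k : ℕ} (h : m ≤ k) (hD : HasCap m D) : HasCap k D :=
  let ⟨p, q, hp, hq, hpq⟩ := hD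
  ⟨p, q, by omega, by omega, hpq⟩

theorem hasCap_of_isLeft (hD : D ∈ verticalFrom n m) {i : Fin n}
    (hi : (D.1 (Sum.inl i)).isLeft) : HasCap m D := by
  obtain ⟨j, hj⟩ := Sum.isLeft_iff.1 hi
  exact ⟨i, j, column_lt_of_isLeft hD hi, column_lt_of_isLeft hD
    (by rw [← hj, D.2.1]; rfl), hj⟩

theorem exists_eq_ofPerm_of_not_hasCap (hD : D ∈ verticalFrom n m) (h : ¬ HasCap m D) :
    ∃ s ∈ permsBelow n m, D = ofPerm s := by
  obtain ⟨s, rfl⟩ := exists_eq_ofPerm fun i =>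
    Sum.not_isLeft.1 fun hi => h (hasCap_of_isLeft hD hi)
  exact ⟨s, ofPerm_mem_verticalFrom_iff.1 hD, rfl⟩

theorem hasCap_of_caps_ne_zero (hD : D ∈ verticalFrom n m) (h : D.caps ≠ 0) : HasCap m D := by
  by_contra hcap
  obtain ⟨s, -, rfl⟩ := exists_eq_ofPerm_of_not_hasCap hD hcap
  exact h (caps_ofPerm s)

theorem sum_verticalFrom_eq_sum_permsBelow {M : Type*} [AddCommMonoid M] {g : BrauerDiagram n → M}
    (hg : ∀ D, HasCap m D → g D = 0) :
    ∑ D ∈ verticalFrom n m, g D = ∑ s ∈ permsBelow n m, g (ofPerm s) := by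
  refine (sum_subset ?_ fun D hD hnot => ?_).symm.trans
    (sum_map (permsBelow n m) ⟨ofPerm, ofPerm_injective⟩ g)
  · simp only [subset_iff, mem_map, Function.Embedding.coeFn_mk]
    rintro _ ⟨s, hs, rfl⟩
    exact ofPerm_mem_verticalFrom_iff.2 hs
  · by_contra hgD
    obtain ⟨s, hs, rfl⟩ := exists_eq_ofPerm_of_not_hasCap hD fun h => hgD (hg D h)
    exact hnot (mem_map.2 ⟨s, hs, rfl⟩)

theorem card_column_lt (hm : m ≤ n) : #{p : Fin n ⊕ Fin n | column p < m} = 2 * m := by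
  have h : #{i : Fin n | i < m} = m := by rw [Fin.card_filter_val_lt, min_eq_right hm]
  rw [card_filter_sum, two_mul]
  exact congrArg₂ (· + ·) h h

theorem card_column_lt_and_isRight (hD : D ∈ verticalFrom n m) :
    #{p : Fin n ⊕ Fin n | column p < m ∧ p.isRight ∧ (D.1 p).isRight} = 2 * D.caps := by
  rw [← card_isRight_and_isRight]
  congr 1
  refine filter_congr fun p _ => and_iff_right_of_imp ?_
  rcases p with i | i
  · simp
  · exact fun h => column_lt_of_isRight hD h.2

theorem sum_verticalFrom_eq_sum_relabel_swap {M : Type*} [AddCommMonoid M]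
    (g : BrauerDiagram n → M) {i j : Fin n} (h : i ≠ j) (hi : i < m) (hj : j < m) :
    ∑ D ∈ verticalFrom n m, g D =
      ∑ G ∈ verticalFrom n m with G.1 (Sum.inl i) = Sum.inl j,
        ∑ p with column p < m ∧ p ≠ Sum.inl i, g (relabel (Equiv.swap (Sum.inl j) p) G) := by
  have hij : (Sum.inl i : Fin n ⊕ Fin n) ≠ Sum.inl j := fun h' => h (Sum.inl_injective h')
  have swap_swap (p) (D : BrauerDiagram n) :
      relabel (Equiv.swap (Sum.inl j) p) (relabel (Equiv.swap (Sum.inl j) p) D) = D := by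
    ext a
    simp [relabel_apply]
  have mem_swap {D : BrauerDiagram n} (hD : D ∈ verticalFrom n m) {p} (hp : column p < m) :
      relabel (Equiv.swap (Sum.inl j) p) D ∈ verticalFrom n m :=
    relabel_mem_verticalFrom (swap_apply_of_column_lt hj hp) hD
  rw [sum_sigma']
  refine sum_bij'
    (fun D _ => ⟨relabel (Equiv.swap (Sum.inl j) (D.1 (Sum.inl i))) D, D.1 (Sum.inl i)⟩)
    (fun x _ => relabel (Equiv.swap (Sum.inl j) x.2) x.1) ?_ ?_ ?_ ?_ ?_
  · intro D hD
    have hp : column (D.1 (Sum.inl i)) < m := column_apply_lt hD hi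
    simp only [mem_sigma, mem_filter, mem_univ, true_and]
    refine ⟨⟨mem_swap hD hp, ?_⟩, hp, D.2.2 _⟩
    rw [relabel_apply, Equiv.symm_swap, Equiv.swap_apply_of_ne_of_ne hij (D.2.2 _).symm,
      Equiv.swap_apply_right]
  · rintro ⟨G, p⟩ hx
    simp only [mem_sigma, mem_filter, mem_univ, true_and] at hx
    exact mem_swap hx.1.1 hx.2.1
  · exact fun D _ => swap_swap _ D
  · rintro ⟨G, p⟩ hx
    simp only [mem_sigma, mem_filter, mem_univ, true_and] at hx
    have hp : (relabel (Equiv.swap (Sum.inl j) p) G).1 (Sum.inl i) = p := by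
      rw [relabel_apply, Equiv.symm_swap, Equiv.swap_apply_of_ne_of_ne hij hx.2.2.symm, hx.1.2,
        Equiv.swap_apply_left]
    simp only [hp, swap_swap]
  · exact fun D _ => by rw [swap_swap]

/-! ### Diagrams without cap and cup on the first `M` strands -/

variable {M : Fin n}

theorem relabel_relabel (σ τ : Equiv.Perm (Fin n ⊕ Fin n)) (D : BrauerDiagram n) :
    relabel σ (relabel τ D) = relabel (σ * τ) D := rfl

/-- Exchanging the end points of the two strands that meet column `M`: this turns the permutation
diagrams that move `M` into the diagrams with a single cap, ending at `M`, and a single cup, also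
ending at `M`. -/
abbrev twist (M : Fin n) : Equiv.Perm (BrauerDiagram n) :=
  relabel (Equiv.swap (Sum.inl M) (Sum.inr M))

theorem twist_twist (M : Fin n) (D : BrauerDiagram n) : twist M (twist M D) = D := by
  ext; simp [relabel_apply]

theorem twist_mem_verticalFrom (hD : D ∈ verticalFrom n (M + 1)) :
    twist M D ∈ verticalFrom n (M + 1) :=
  have column_lt : column (Sum.inl M) < M + 1 := M.1.lt_succ_self
  relabel_mem_verticalFrom (swap_apply_of_column_lt column_lt column_lt) hD

theorem twist_relabel_sumCongr {s t : Equiv.Perm (Fin n)} (hs : s M = M) (ht : t M = M)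
    (D : BrauerDiagram n) :
    twist M (relabel (Equiv.sumCongr s t) D) = relabel (Equiv.sumCongr s t) (twist M D) := by
  have hswap := Equiv.mul_swap_eq_swap_mul (Equiv.sumCongr s t) (Sum.inl M) (Sum.inr M)
  rw [Equiv.sumCongr_apply, Equiv.sumCongr_apply, Sum.map_inl, Sum.map_inr, hs, ht] at hswap
  rw [relabel_relabel, relabel_relabel, hswap]

theorem twist_ofPerm_swap {L : Fin n} (h : L ≠ M) :
    twist M (ofPerm (Equiv.swap L M)) = cupCap L M h := by
  ext a
  simp only [relabel_apply, Equiv.symm_swap, ofPerm, cupCap]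
  rcases a with k | k <;> by_cases hkL : k = L <;> by_cases hkM : k = M <;>
    simp_all [Equiv.swap_apply_def]

theorem twist_apply_inl_of_apply_inr {j : Fin n} (hj : D.1 (Sum.inr M) = Sum.inr j) :
    (twist M D).1 (Sum.inl M) = Sum.inr j := by
  have hjM : (Sum.inr j : Fin n ⊕ Fin n) ≠ Sum.inr M := hj ▸ D.2.2 _
  rw [relabel_apply, Equiv.symm_swap, Equiv.swap_apply_left, hj,
    Equiv.swap_apply_of_ne_of_ne Sum.inr_ne_inl hjM]

theorem HasCap.of_twist (h : HasCap M (twist M D)) : HasCap M D := by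
  obtain ⟨p, q, hp, hq, hpq⟩ := h
  have swap_apply {r : Fin n} (hr : r < M) :
      Equiv.swap (Sum.inl M) (Sum.inr M) (Sum.inl r) = Sum.inl r :=
    Equiv.swap_apply_of_ne_of_ne (Sum.inl_injective.ne hr.ne) Sum.inl_ne_inr
  rw [relabel_apply, Equiv.symm_swap, swap_apply hp, Equiv.swap_apply_eq_iff, swap_apply hq] at hpq
  exact ⟨p, q, hp, hq, hpq⟩

theorem HasCap.exists_apply_eq_of_not_hasCap (h : HasCap (M + 1) D) (hM : ¬ HasCap M D) :
    ∃ i, D.1 (Sum.inl M) = Sum.inl i := by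
  obtain ⟨p, q, hp, hq, hpq⟩ := h
  rcases (Nat.lt_succ_iff_lt_or_eq.1 hp) with hp | hp
  · rcases (Nat.lt_succ_iff_lt_or_eq.1 hq) with hq | hq
    · exact absurd ⟨p, q, hp, hq, hpq⟩ hM
    · exact ⟨p, by rw [← Fin.ext hq, ← hpq, D.2.1]⟩
  · exact ⟨q, by rw [← Fin.ext hp, hpq]⟩

theorem exists_eq_ofPerm_or_eq_twist (hD : D ∈ verticalFrom n (M + 1)) (hcap : ¬ HasCap M D)
    (hcup : ¬ HasCap M (mirror D)) :
    ∃ s ∈ permsBelow n (M + 1), D = ofPerm s ∨ s M ≠ M ∧ D = twist M (ofPerm s) := by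
  by_cases h : HasCap (M + 1) D
  · obtain ⟨i, hi⟩ := h.exists_apply_eq_of_not_hasCap hcap
    have caps_mirror_ne : (mirror D).caps ≠ 0 := by
      rw [caps_mirror]
      exact (caps_pos (by rw [hi]; rfl)).ne'
    obtain ⟨j, hj⟩ := (hasCap_of_caps_ne_zero (mirror_mem_verticalFrom hD)
      caps_mirror_ne).exists_apply_eq_of_not_hasCap hcup
    have hDM : D.1 (Sum.inr M) = Sum.inr j := by
      rw [← Sum.swap_swap (D.1 _)]
      exact congrArg Sum.swap hj
    have htwist := twist_apply_inl_of_apply_inr hDM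
    have hnot : ¬ HasCap (M + 1) (twist M D) := fun htw => by
      obtain ⟨k, hk⟩ := htw.exists_apply_eq_of_not_hasCap fun h => hcap h.of_twist
      exact Sum.inl_ne_inr (hk.symm.trans htwist)
    obtain ⟨s, hs, hsD⟩ := exists_eq_ofPerm_of_not_hasCap (twist_mem_verticalFrom hD) hnot
    have hsM : s M = j := Sum.inr_injective (by rw [← htwist, hsD]; rfl)
    refine ⟨s, hs, Or.inr ⟨fun hfix => ?_, by rw [← hsD, twist_twist]⟩⟩
    exact D.2.2 (Sum.inr M) (by rw [hDM, ← hsM, hfix])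
  · obtain ⟨s, hs, rfl⟩ := exists_eq_ofPerm_of_not_hasCap hD h
    exact ⟨s, hs, Or.inl rfl⟩

theorem caps_twist_ofPerm {s : Equiv.Perm (Fin n)} (hs : s M ≠ M) :
    (twist M (ofPerm s)).caps = 1 := by
  have hcup : (twist M (ofPerm s)).1 (Sum.inr M) = Sum.inr (s M) := by
    rw [relabel_apply, Equiv.symm_swap, Equiv.swap_apply_right]
    exact Equiv.swap_apply_of_ne_of_ne Sum.inr_ne_inl (Sum.inr_injective.ne hs)
  have hcap : (twist M (ofPerm s)).1 (Sum.inl M) = Sum.inl (s.symm M) := by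
    rw [relabel_apply, Equiv.symm_swap, Equiv.swap_apply_left]
    refine Equiv.swap_apply_of_ne_of_ne (Sum.inl_injective.ne fun h => hs ?_) Sum.inl_ne_inr
    exact (s.symm_apply_eq.1 h).symm
  have hcap' : (twist M (ofPerm s)).1 (Sum.inl (s.symm M)) = Sum.inl M := by
    rw [← hcap, (twist M (ofPerm s)).2.1]
  have := caps_relabel_swap_inl_inr hcap' hcup
  rw [twist_twist, caps_ofPerm] at this
  exact this.symm

theorem sum_verticalFrom_succ {A : Type*} [AddCommMonoid A] {g : BrauerDiagram n → A}
    (hcap : ∀ D, HasCap M D → g D = 0) (hcup : ∀ D, HasCap M (mirror D) → g D = 0) :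
    ∑ D ∈ verticalFrom n (M + 1), g D =
      ∑ s ∈ permsBelow n (M + 1), g (ofPerm s) +
        ∑ s ∈ permsBelow n (M + 1) with s M ≠ M, g (twist M (ofPerm s)) := by
  let perms := (permsBelow n (M + 1)).map ⟨ofPerm, ofPerm_injective⟩
  let twisted := ({s ∈ permsBelow n (M + 1) | s M ≠ M}).map
    ⟨fun s => twist M (ofPerm s), (twist M).injective.comp ofPerm_injective⟩
  have mem_perms {D} : D ∈ perms ↔ ∃ s ∈ permsBelow n (M + 1), ofPerm s = D := mem_map
  have mem_twisted {D} : D ∈ twisted ↔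
      ∃ s, (s ∈ permsBelow n (M + 1) ∧ s M ≠ M) ∧ twist M (ofPerm s) = D := by
    simp only [twisted, mem_map, mem_filter, Function.Embedding.coeFn_mk]
  have disjoint : Disjoint perms twisted := by
    simp only [disjoint_left, mem_perms, mem_twisted]
    rintro D ⟨s, -, rfl⟩ ⟨t, ⟨-, ht⟩, hst⟩
    have := caps_twist_ofPerm ht
    rw [hst, caps_ofPerm] at this
    exact zero_ne_one this
  have subset : perms.disjUnion twisted disjoint ⊆ verticalFrom n (M + 1) := by
    simp only [subset_iff, mem_disjUnion, mem_perms, mem_twisted]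
    rintro _ (⟨s, hs, rfl⟩ | ⟨s, ⟨hs, -⟩, rfl⟩)
    · exact ofPerm_mem_verticalFrom_iff.2 hs
    · exact twist_mem_verticalFrom (ofPerm_mem_verticalFrom_iff.2 hs)
  rw [← sum_subset subset, sum_disjUnion, sum_map, sum_map]
  · rfl
  · intro D hD hnot
    by_contra hgD
    obtain ⟨s, hs, rfl | ⟨hsM, rfl⟩⟩ :=
      exists_eq_ofPerm_or_eq_twist hD (fun h => hgD (hcap D h)) fun h => hgD (hcup D h)
    · exact hnot (mem_disjUnion.2 (Or.inl (mem_perms.2 ⟨s, hs, rfl⟩)))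
    · exact hnot (mem_disjUnion.2 (Or.inr (mem_twisted.2 ⟨s, ⟨hs, hsM⟩, rfl⟩)))

theorem filter_permsBelow_succ (M : Fin n) :
    {s ∈ permsBelow n (M + 1) | s M = M} = permsBelow n M := by
  ext s
  simp only [mem_filter, mem_permsBelow]
  refine ⟨fun ⟨hs, hM⟩ i hi => ?_, fun hs => ⟨fun i hi => hs i (by omega), hs M le_rfl⟩⟩
  rcases hi.eq_or_lt with hi | hi
  · rwa [← Fin.ext hi]
  · exact hs i hi

theorem card_filter_permsBelow_succ_ne (M : Fin n) :
    #{s ∈ permsBelow n (M + 1) | s M ≠ M} = M * (M : ℕ).factorial := by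
  have := card_filter_add_card_filter_not (s := permsBelow n (M + 1)) (fun s => s M = M)
  rw [filter_permsBelow_succ, card_permsBelow M.2.le, card_permsBelow M.2,
    Nat.factorial_succ] at this
  linarith

theorem exists_eq_mul_swap_mul {L : Fin n} (h : L < M) {s : Equiv.Perm (Fin n)}
    (hs : s ∈ permsBelow n (M + 1)) (hsM : s M ≠ M) :
    ∃ a ∈ permsBelow n M, ∃ b ∈ permsBelow n M, s = b * Equiv.swap L M * a := by
  rw [mem_permsBelow] at hs
  obtain ⟨i, hi⟩ := s.surjective M
  have hiM : i < M := by
    rcases lt_trichotomy i M with hlt | rfl | hgt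
    · exact hlt
    · exact absurd hi hsM
    · exact absurd ((hs i hgt).symm.trans hi) hgt.ne'
  have fixed (k : Fin n) (hk : (M : ℕ) ≤ k) : Equiv.swap i L k = k :=
    Equiv.swap_apply_of_ne_of_ne (hiM.trans_le hk).ne' (h.trans_le hk).ne'
  refine ⟨Equiv.swap i L, mem_permsBelow.2 fixed, s * Equiv.swap i L * Equiv.swap L M,
    mem_permsBelow.2 fun k hk => ?_, by simp only [mul_assoc, Equiv.swap_mul_self, mul_one]⟩
  simp only [Equiv.Perm.mul_apply]
  rcases hk.eq_or_lt with hk | hk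
  · rw [← Fin.ext hk, Equiv.swap_apply_right, Equiv.swap_apply_right, hi]
  · rw [Equiv.swap_apply_of_ne_of_ne (h.trans hk).ne' (Fin.ne_of_gt hk), fixed k hk.le, hs k hk]

theorem relabel_sumCongr_ofPerm (a b s : Equiv.Perm (Fin n)) :
    relabel (Equiv.sumCongr a⁻¹ b) (ofPerm s) = ofPerm (b * s * a) := by
  ext (k | k) <;> rfl

end BrauerDiagram

namespace VTL

open BrauerDiagram

variable {K : Type*} [Field K] {n : ℕ} {d : K}

theorem linearCombination_linearCombination {ι M : Type*} [AddCommGroup M] [Module K M]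
    (t : ι → ι → K) (w : ι → ι → M) (a b : ι →₀ K) :
    Finsupp.linearCombination K (fun D => Finsupp.linearCombination K fun E => t D E • w D E) a b =
      a.sum fun D r => b.sum fun E s => (r * s * t D E) • w D E := by
  simp only [Finsupp.linearCombination_apply, Finsupp.sum, LinearMap.sum_apply,
    LinearMap.smul_apply, smul_sum, smul_smul, mul_assoc]

/-- The product of the Brauer algebra as a bilinear map, which gives the ring axioms other than
associativity and the unit laws. -/
noncomputable def mulBilin (n : ℕ) (d : K) : VTL n d →ₗ[K] VTL n d →ₗ[K] VTL n d :=
  Finsupp.linearCombination K (M := VTL n d →ₗ[K] VTL n d) fun D : BrauerDiagram n =>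
    Finsupp.linearCombination K (M := VTL n d) fun E : BrauerDiagram n =>
      d ^ loops D E • diag d (comp D E)

theorem mul_eq_mulBilin (a b : VTL n d) : a * b = mulBilin n d a b :=
  (linearCombination_linearCombination (fun D E => d ^ loops D E)
    (fun D E => diag d (comp D E)) a b).symm

protected theorem add_mul (a b c : VTL n d) : (a + b) * c = a * c + b * c := by
  simp only [mul_eq_mulBilin, map_add, LinearMap.add_apply]

protected theorem mul_add (a b c : VTL n d) : a * (b + c) = a * b + a * c := by
  simp only [mul_eq_mulBilin, map_add]

protected theorem smul_mul (r : K) (a b : VTL n d) : (r • a) * b = r • (a * b) := by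
  simp only [mul_eq_mulBilin, map_smul, LinearMap.smul_apply]

protected theorem mul_smul (r : K) (a b : VTL n d) : a * (r • b) = r • (a * b) := by
  simp only [mul_eq_mulBilin, map_smul]

theorem diag_mul_diag (D E : BrauerDiagram n) :
    diag d D * diag d E = d ^ loops D E • diag d (comp D E) := by
  change (Finsupp.single D (1 : K)).sum (fun D r => (Finsupp.single E (1 : K)).sum fun E s =>
    (r * s * d ^ loops D E) • diag d (comp D E)) = _
  rw [Finsupp.sum_single_index, Finsupp.sum_single_index] <;> simp

theorem diag_mul_diag_of_colourMatrix {D E G : BrauerDiagram n} {k : ℕ}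
    (h : colourMatrix D * colourMatrix E = 2 ^ k • colourMatrix G) :
    diag d D * diag d E = d ^ k • diag d G := by
  obtain ⟨hcomp, hloops⟩ := comp_eq_and_loops_eq h
  rw [diag_mul_diag, hcomp, hloops]

theorem induction_diag {p : VTL n d → Prop} (a : VTL n d)
    (add : ∀ a b, p a → p b → p (a + b)) (smul_diag : ∀ (r : K) D, p (r • diag d D)) : p a := by
  refine Finsupp.induction_linear (motive := p) a ?_ add fun D r => ?_
  · exact zero_smul K (diag d (ofPerm 1)) ▸ smul_diag 0 _
  · have : Finsupp.single D r = r • Finsupp.single D (1 : K) := by simp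
    rw [this]
    exact smul_diag r D

noncomputable scoped instance : Ring (VTL n d) where
  __ := (inferInstance : AddCommGroup (VTL n d))
  left_distrib := VTL.mul_add
  right_distrib := VTL.add_mul
  zero_mul a := by simp only [mul_eq_mulBilin, map_zero, LinearMap.zero_apply]
  mul_zero a := by simp only [mul_eq_mulBilin, map_zero]
  one_mul a := by
    induction a using induction_diag with
    | add a b ha hb => rw [VTL.mul_add, ha, hb]
    | smul_diag r D =>
      have : 1 * diag d D = d ^ 0 • diag d D := diag_mul_diag_of_colourMatrix (by
        rw [colourMatrix_ofPerm_one, one_mul, pow_zero, one_smul])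
      rw [VTL.mul_smul, this, pow_zero, one_smul]
  mul_one a := by
    induction a using induction_diag with
    | add a b ha hb => rw [VTL.add_mul, ha, hb]
    | smul_diag r D =>
      have : diag d D * 1 = d ^ 0 • diag d D := diag_mul_diag_of_colourMatrix (by
        rw [colourMatrix_ofPerm_one, mul_one, pow_zero, one_smul])
      rw [VTL.smul_mul, this, pow_zero, one_smul]
  mul_assoc a b c := by
    induction a using induction_diag with
    | add a a' h h' => simp only [VTL.add_mul, h, h']
    | smul_diag r D =>
    induction b using induction_diag with
    | add b b' h h' => simp only [VTL.add_mul, VTL.mul_add, h, h']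
    | smul_diag s E =>
    induction c using induction_diag with
    | add c c' h h' => simp only [VTL.mul_add, h, h']
    | smul_diag t G =>
    obtain ⟨hcomp, hloops⟩ := comp_assoc_and_loops_add_loops D E G
    simp only [VTL.smul_mul, VTL.mul_smul, diag_mul_diag, hcomp]
    simp only [smul_comm _ r, smul_smul (d ^ _), ← pow_add, hloops]

noncomputable scoped instance : Algebra K (VTL n d) :=
  Algebra.ofModule VTL.smul_mul fun r a b => VTL.mul_smul r a b

/-- The anti-automorphism of the Brauer algebra that turns diagrams upside down, as a linear map. It
transfers statements about left multiplication to right multiplication. -/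
noncomputable def mirrorLin (n : ℕ) (d : K) : VTL n d →ₗ[K] VTL n d :=
  Finsupp.linearCombination K (M := VTL n d) fun D : BrauerDiagram n => diag d (mirror D)

theorem mirrorLin_diag (D : BrauerDiagram n) : mirrorLin n d (diag d D) = diag d (mirror D) :=
  (Finsupp.linearCombination_single (M := VTL n d) K 1 D).trans (one_smul _ _)

theorem mirrorLin_mul (a b : VTL n d) :
    mirrorLin n d (a * b) = mirrorLin n d b * mirrorLin n d a := by
  induction a using induction_diag with
  | add a a' h h' => simp only [add_mul, mul_add, map_add, h, h']
  | smul_diag r D =>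
  induction b using induction_diag with
  | add b b' h h' => simp only [add_mul, mul_add, map_add, h, h']
  | smul_diag s E =>
  have : diag d (mirror E) * diag d (mirror D) = d ^ loops D E • diag d (mirror (comp D E)) :=
    diag_mul_diag_of_colourMatrix (by
      simp only [colourMatrix_mirror, ← Matrix.transpose_mul, colourMatrix_mul,
        Matrix.transpose_smul])
  simp only [map_smul, mirrorLin_diag, smul_mul_assoc, mul_smul_comm, diag_mul_diag D E, this,
    smul_comm s r]

theorem diag_ofPerm_mul_diag (s : Equiv.Perm (Fin n)) (D : BrauerDiagram n) :
    diag d (ofPerm s) * diag d D = diag d (relabel (Equiv.sumCongr s⁻¹ 1) D) := by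
  rw [diag_mul_diag_of_colourMatrix (k := 0) (by rw [colourMatrix_ofPerm_mul, pow_zero, one_smul]),
    pow_zero, one_smul]

/-! ### The symmetrizer -/

variable {m : ℕ}

/-- The coefficient in the symmetrizer on `m` strands of a diagram with `l` caps. -/
def weight (d : K) (m l : ℕ) : K :=
  (-2) ^ l * l.factorial / (m.factorial * ∏ i ∈ Icc 1 l, (d + 2 * (m : K) - 2 - 2 * (i : K)))

theorem weight_zero (d : K) (m : ℕ) : weight d m 0 = (m.factorial : K)⁻¹ := by
  simp [weight]

theorem weight_succ_mul {l : ℕ} (h : d + 2 * (m : K) - 2 - 2 * ((l + 1 : ℕ) : K) ≠ 0) :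
    weight d m (l + 1) * (d + 2 * (m : K) - 2 - 2 * ((l + 1 : ℕ) : K)) =
      -2 * ((l + 1 : ℕ) : K) * weight d m l := by
  rw [weight, weight, prod_Icc_succ_top (by omega), Nat.factorial_succ, pow_succ,
    ← mul_assoc, div_mul_eq_mul_div, mul_div_mul_right _ _ h]
  push_cast
  ring

theorem loop_weight_ne_zero (hd : ∀ j : ℕ, j + 2 ≤ m → d ≠ -2 * (j : K)) {l : ℕ} (hl : l + 2 ≤ m) :
    d + 2 * (m : K) - 2 - 2 * ((l + 1 : ℕ) : K) ≠ 0 := by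
  intro h
  obtain ⟨k, rfl⟩ := Nat.exists_eq_add_of_le hl
  refine hd k (by omega) ?_
  push_cast at h
  linear_combination h

/-- The explicit symmetrizer on the first `m` of `n` strands, a candidate for `f_m`: the sum of all
diagrams on these strands, weighted by their number of caps. -/
noncomputable def symmetrizer (n : ℕ) (d : K) (m : ℕ) : VTL n d :=
  ∑ D ∈ verticalFrom n m, weight d m D.caps • diag d D

theorem ofPerm_mul_symmetrizer {s : Equiv.Perm (Fin n)} (hs : s ∈ permsBelow n m) :
    diag d (ofPerm s) * symmetrizer n d m = symmetrizer n d m := by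
  simp only [symmetrizer, mul_sum, mul_smul_comm, diag_ofPerm_mul_diag]
  have fixed := sumCongr_apply_of_mem_permsBelow (inv_mem_permsBelow hs)
    (mem_permsBelow.2 fun i _ => rfl : 1 ∈ permsBelow n m)
  exact sum_equiv (relabel (Equiv.sumCongr s⁻¹ 1))
    (fun D => (relabel_mem_verticalFrom_iff fixed).symm)
    fun D _ => by rw [caps_relabel_sumCongr]

theorem mirrorLin_symmetrizer : mirrorLin n d (symmetrizer n d m) = symmetrizer n d m := by
  simp only [symmetrizer, map_sum, map_smul, mirrorLin_diag]
  refine sum_equiv mirror (fun D => ⟨mirror_mem_verticalFrom, fun h => ?_⟩)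
    fun D _ => by rw [caps_mirror]
  exact mirror_mirror D ▸ mirror_mem_verticalFrom h

theorem symmetrizer_mul_ofPerm {s : Equiv.Perm (Fin n)} (hs : s ∈ permsBelow n m) :
    symmetrizer n d m * diag d (ofPerm s) = symmetrizer n d m := by
  have := congrArg (mirrorLin n d) (ofPerm_mul_symmetrizer (d := d) (inv_mem_permsBelow hs))
  rwa [mirrorLin_mul, mirrorLin_symmetrizer, mirrorLin_diag, mirror_ofPerm, inv_inv] at this

theorem sum_caps_relabel_swap (hm : m ≤ n) {G : BrauerDiagram n} (hG : G ∈ verticalFrom n m)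
    {i j : Fin n} (hij : G.1 (Sum.inl i) = Sum.inl j) (w : ℕ → K) :
    ∑ p with column p < m ∧ p ≠ Sum.inl i,
        w (relabel (Equiv.swap (Sum.inl j) p) G).caps * d ^ (if p = Sum.inl j then 1 else 0) =
      (d + 2 * (m : K) - 2 - 2 * (G.caps : K)) * w G.caps + 2 * (G.caps : K) * w (G.caps - 1) := by
  have hji : G.1 (Sum.inl j) = Sum.inl i := by rw [← hij, G.2.1]
  have hi : i < m := column_lt_of_isLeft hG (by rw [hij]; rfl)
  have hj : j < m := column_lt_of_isLeft hG (by rw [hji]; rfl)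
  have hne : (Sum.inl j : Fin n ⊕ Fin n) ≠ Sum.inl i := hij ▸ G.2.2 _
  have term (p : Fin n ⊕ Fin n) :
      w (relabel (Equiv.swap (Sum.inl j) p) G).caps * d ^ (if p = Sum.inl j then 1 else 0) =
        w G.caps + (if p.isRight ∧ (G.1 p).isRight then w (G.caps - 1) - w G.caps else 0) +
          (if p = Sum.inl j then (d - 1) * w G.caps else 0) := by
    rw [caps_relabel_swap hij]
    by_cases hp : p = Sum.inl j
    · subst hp
      simp only [Sum.isRight_inl, Bool.false_eq_true, false_and, if_false, if_true]
      ring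
    · simp only [if_neg hp]
      split_ifs <;> ring
  have mem_i : Sum.inl i ∈ ({p | column p < m} : Finset (Fin n ⊕ Fin n)) :=
    (mem_filter_univ _).2 hi
  have card_all : (#{p : Fin n ⊕ Fin n | column p < m ∧ p ≠ Sum.inl i} : K) = 2 * (m : K) - 1 := by
    rw [← filter_filter, filter_ne', cast_card_erase_of_mem mem_i,
      card_column_lt hm]
    push_cast
    ring
  have card_right : #{p : Fin n ⊕ Fin n | (column p < m ∧ p ≠ Sum.inl i) ∧
      p.isRight ∧ (G.1 p).isRight} = 2 * G.caps := by
    rw [← card_column_lt_and_isRight hG]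
    congr 1
    refine filter_congr fun p _ => ?_
    rcases p with k | k <;> simp
  have mem_j : Sum.inl j ∈ ({p | column p < m ∧ p ≠ Sum.inl i} : Finset (Fin n ⊕ Fin n)) :=
    (mem_filter_univ _).2 ⟨hj, hne⟩
  simp only [term, sum_add_distrib]
  rw [sum_const, nsmul_eq_mul, card_all, ← sum_filter, filter_filter, sum_const, card_right,
    sum_ite_eq', if_pos mem_j, nsmul_eq_mul]
  push_cast
  ring

theorem sum_weight_relabel_swap (hm : m ≤ n) (hd : ∀ j : ℕ, j + 2 ≤ m → d ≠ -2 * (j : K))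
    {G : BrauerDiagram n} (hG : G ∈ verticalFrom n m) {i j : Fin n}
    (hij : G.1 (Sum.inl i) = Sum.inl j) :
    ∑ p with column p < m ∧ p ≠ Sum.inl i, weight d m (relabel (Equiv.swap (Sum.inl j) p) G).caps *
      d ^ (if p = Sum.inl j then 1 else 0) = 0 := by
  rw [sum_caps_relabel_swap hm hG hij]
  obtain ⟨l, hl⟩ := Nat.exists_eq_add_one.2 (caps_pos (D := G) (i := i) (by rw [hij]; rfl))
  have hlm : l + 2 ≤ m := by have := two_mul_caps_le hG; omega
  rw [hl, Nat.add_sub_cancel]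
  linear_combination weight_succ_mul (loop_weight_ne_zero hd hlm)

theorem cupCap_mul_symmetrizer (hm : m ≤ n) (hd : ∀ j : ℕ, j + 2 ≤ m → d ≠ -2 * (j : K))
    {i j : Fin n} (h : i ≠ j) (hi : i < m) (hj : j < m) :
    diag d (cupCap i j h) * symmetrizer n d m = 0 := by
  rw [symmetrizer, mul_sum, sum_verticalFrom_eq_sum_relabel_swap _ h hi hj]
  refine sum_eq_zero fun G hG => ?_
  obtain ⟨hGm, hij⟩ := mem_filter.1 hG
  calc _ = ∑ p with column p < m ∧ p ≠ Sum.inl i,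
        (weight d m (relabel (Equiv.swap (Sum.inl j) p) G).caps *
          d ^ (if p = Sum.inl j then 1 else 0)) • diag d G := by
        refine sum_congr rfl fun p hp => ?_
        rw [mul_smul_comm, diag_mul_diag_of_colourMatrix
          (colourMatrix_cupCap_mul h hij (mem_filter.1 hp).2.2), smul_smul]
    _ = 0 := by rw [← sum_smul, sum_weight_relabel_swap hm hd hGm hij, zero_smul]

theorem symmetrizer_mul_cupCap (hm : m ≤ n) (hd : ∀ j : ℕ, j + 2 ≤ m → d ≠ -2 * (j : K))
    {i j : Fin n} (h : i ≠ j) (hi : i < m) (hj : j < m) :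
    symmetrizer n d m * diag d (cupCap i j h) = 0 := by
  have := congrArg (mirrorLin n d) (cupCap_mul_symmetrizer hm hd h hi hj)
  rwa [mirrorLin_mul, mirrorLin_symmetrizer, mirrorLin_diag, mirror_cupCap, map_zero] at this

theorem symmetrizer_mul_diag_of_hasCap (hm : m ≤ n) (hd : ∀ j : ℕ, j + 2 ≤ m → d ≠ -2 * (j : K))
    {D : BrauerDiagram n} (hD : HasCap m D) : symmetrizer n d m * diag d D = 0 := by
  obtain ⟨i, j, hi, hj, hij⟩ := hD
  have h : i ≠ j := fun h => D.2.2 (Sum.inl i) (by rw [hij, h])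
  have factor := diag_mul_diag_of_colourMatrix (d := d)
    (colourMatrix_cupCap_mul h hij (p := Sum.inr i) Sum.inr_ne_inl)
  rw [if_neg Sum.inr_ne_inl, pow_zero, one_smul] at factor
  rw [← factor, ← mul_assoc, symmetrizer_mul_cupCap hm hd h hi hj, zero_mul]

theorem diag_mul_symmetrizer_of_hasCap_mirror (hm : m ≤ n)
    (hd : ∀ j : ℕ, j + 2 ≤ m → d ≠ -2 * (j : K)) {D : BrauerDiagram n}
    (hD : HasCap m (mirror D)) : diag d D * symmetrizer n d m = 0 := by
  have := congrArg (mirrorLin n d) (symmetrizer_mul_diag_of_hasCap hm hd hD)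
  rwa [mirrorLin_mul, mirrorLin_symmetrizer, mirrorLin_diag, mirror_mirror, map_zero] at this

theorem symmetrizer_mul_symmetrizer_of_le {k : ℕ} (hmk : m ≤ k) (hk : k ≤ n)
    (hm : (m.factorial : K) ≠ 0) (hd : ∀ j : ℕ, j + 2 ≤ k → d ≠ -2 * (j : K)) :
    symmetrizer n d k * symmetrizer n d m = symmetrizer n d k := by
  calc symmetrizer n d k * symmetrizer n d m
      = ∑ D ∈ verticalFrom n m, weight d m D.caps • (symmetrizer n d k * diag d D) := by
        simp only [symmetrizer, mul_sum, mul_smul_comm]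
    _ = ∑ _s ∈ permsBelow n m, (m.factorial : K)⁻¹ • symmetrizer n d k := by
        rw [sum_verticalFrom_eq_sum_permsBelow fun D hD => by
          rw [symmetrizer_mul_diag_of_hasCap hk hd (hD.mono hmk), smul_zero]]
        refine sum_congr rfl fun s hs => ?_
        rw [symmetrizer_mul_ofPerm (permsBelow_mono hmk hs), caps_ofPerm, weight_zero]
    _ = symmetrizer n d k := by
        rw [sum_const, card_permsBelow (hmk.trans hk), ← Nat.cast_smul_eq_nsmul K, smul_smul,
          mul_inv_cancel₀ hm, one_smul]

theorem symmetrizer_mul_symmetrizer_of_ge {k : ℕ} (hmk : m ≤ k) (hk : k ≤ n)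
    (hm : (m.factorial : K) ≠ 0) (hd : ∀ j : ℕ, j + 2 ≤ k → d ≠ -2 * (j : K)) :
    symmetrizer n d m * symmetrizer n d k = symmetrizer n d k := by
  have := congrArg (mirrorLin n d) (symmetrizer_mul_symmetrizer_of_le hmk hk hm hd)
  rwa [mirrorLin_mul, mirrorLin_symmetrizer, mirrorLin_symmetrizer] at this

theorem diag_mul_diag_ofPerm (s : Equiv.Perm (Fin n)) (D : BrauerDiagram n) :
    diag d D * diag d (ofPerm s) = diag d (relabel (Equiv.sumCongr 1 s) D) := by
  have hconj : (Equiv.sumComm _ _ : Equiv.Perm (Fin n ⊕ Fin n)) *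
      Equiv.sumCongr s 1 * Equiv.sumComm _ _ = Equiv.sumCongr 1 s := by
    ext (k | k) <;> rfl
  have := congrArg (mirrorLin n d) (diag_ofPerm_mul_diag (d := d) s⁻¹ (mirror D))
  rwa [mirrorLin_mul, mirrorLin_diag, mirrorLin_diag, mirrorLin_diag, mirror_mirror, mirror_ofPerm,
    inv_inv, relabel_relabel, relabel_relabel, hconj] at this

theorem symmetrizer_mul_relabel_mul_symmetrizer {a b : Equiv.Perm (Fin n)}
    (ha : a ∈ permsBelow n m) (hb : b ∈ permsBelow n m) (D : BrauerDiagram n) :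
    symmetrizer n d m * diag d (relabel (Equiv.sumCongr a⁻¹ b) D) * symmetrizer n d m =
      symmetrizer n d m * diag d D * symmetrizer n d m := by
  have factor : diag d (relabel (Equiv.sumCongr a⁻¹ b) D) =
      diag d (ofPerm a) * diag d D * diag d (ofPerm b) := by
    rw [diag_ofPerm_mul_diag, diag_mul_diag_ofPerm, relabel_relabel]
    exact congrArg (fun σ => diag d (relabel σ D)) (by ext (k | k) <;> rfl)
  calc _ = symmetrizer n d m * diag d (ofPerm a) * diag d D *
        (diag d (ofPerm b) * symmetrizer n d m) := by rw [factor]; noncomm_ring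
    _ = _ := by rw [symmetrizer_mul_ofPerm ha, ofPerm_mul_symmetrizer hb]

theorem symmetrizer_mul_ofPerm_mul_symmetrizer {L M : Fin n} (h : L < M) {s : Equiv.Perm (Fin n)}
    (hs : s ∈ permsBelow n (M + 1)) (hsM : s M ≠ M) :
    symmetrizer n d M * diag d (ofPerm s) * symmetrizer n d M =
      symmetrizer n d M * diag d (ofPerm (Equiv.swap L M)) * symmetrizer n d M := by
  obtain ⟨a, ha, b, hb, rfl⟩ := exists_eq_mul_swap_mul h hs hsM
  rw [← relabel_sumCongr_ofPerm, symmetrizer_mul_relabel_mul_symmetrizer ha hb]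

theorem symmetrizer_mul_twist_mul_symmetrizer {L M : Fin n} (h : L < M) {s : Equiv.Perm (Fin n)}
    (hs : s ∈ permsBelow n (M + 1)) (hsM : s M ≠ M) :
    symmetrizer n d M * diag d (twist M (ofPerm s)) * symmetrizer n d M =
      symmetrizer n d M * diag d (cupCap L M h.ne) * symmetrizer n d M := by
  obtain ⟨a, ha, b, hb, rfl⟩ := exists_eq_mul_swap_mul h hs hsM
  rw [← relabel_sumCongr_ofPerm, twist_relabel_sumCongr
    (mem_permsBelow.1 (inv_mem_permsBelow ha) M le_rfl) (mem_permsBelow.1 hb M le_rfl),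
    symmetrizer_mul_relabel_mul_symmetrizer ha hb, twist_ofPerm_swap]

theorem factorial_mul_weight_zero (hm : (m.factorial : K) ≠ 0) (d : K) :
    m.factorial * weight d (m + 1) 0 = x K m := by
  rw [weight_zero, x, Nat.factorial_succ]
  push_cast
  field_simp

theorem mul_factorial_mul_weight_zero (hm : (m.factorial : K) ≠ 0) (d : K) :
    m * m.factorial * weight d (m + 1) 0 = z K m := by
  rw [mul_assoc, factorial_mul_weight_zero hm, x, z, mul_one_div]

theorem mul_factorial_mul_weight_one (hm : (m.factorial : K) ≠ 0) (d : K) :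
    m * m.factorial * weight d (m + 1) 1 = y d m := by
  have hden : d + 2 * ((m : K) + 1) - 2 - 2 * 1 = d + 2 * (m : K) - 2 := by ring
  rw [weight, y, Nat.factorial_succ m, Icc_self, prod_singleton, Nat.factorial_one]
  push_cast
  rw [hden]
  field_simp

theorem mul_symmetrizer_mul (a b : VTL n d) :
    a * symmetrizer n d m * b = ∑ D ∈ verticalFrom n m, weight d m D.caps • (a * diag d D * b) := by
  simp only [symmetrizer, mul_sum, sum_mul, mul_smul_comm, smul_mul_assoc]

theorem symmetrizer_succ_eq_sum {M : Fin n} (hM : ((M : ℕ).factorial : K) ≠ 0)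
    (hd : ∀ j : ℕ, j + 2 ≤ (M : ℕ) + 1 → d ≠ -2 * (j : K)) :
    symmetrizer n d (M + 1) =
      ∑ s ∈ permsBelow n (M + 1), weight d (M + 1) 0 •
        (symmetrizer n d M * diag d (ofPerm s) * symmetrizer n d M) +
      ∑ s ∈ permsBelow n (M + 1) with s M ≠ M, weight d (M + 1) 1 •
        (symmetrizer n d M * diag d (twist M (ofPerm s)) * symmetrizer n d M) := by
  have hdM (j : ℕ) (hj : j + 2 ≤ (M : ℕ)) : d ≠ -2 * (j : K) := hd j (by omega)
  calc symmetrizer n d (M + 1)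
      = symmetrizer n d M * symmetrizer n d (M + 1) * symmetrizer n d M := by
        rw [symmetrizer_mul_symmetrizer_of_ge (Nat.le_succ M) M.2 hM hd,
          symmetrizer_mul_symmetrizer_of_le (Nat.le_succ M) M.2 hM hd]
    _ = _ := by
        rw [mul_symmetrizer_mul, sum_verticalFrom_succ
          (fun D hD => by
            rw [symmetrizer_mul_diag_of_hasCap M.2.le hdM hD, zero_mul, smul_zero])
          (fun D hD => by
            rw [mul_assoc, diag_mul_symmetrizer_of_hasCap_mirror M.2.le hdM hD, mul_zero,
              smul_zero])]
        simp only [caps_ofPerm]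
        congr 1
        exact sum_congr rfl fun s hs => by rw [caps_twist_ofPerm (mem_filter.1 hs).2]

theorem sum_symmetrizer_mul_ofPerm_mul_symmetrizer {L M : Fin n} (h : L < M)
    (hM : ((M : ℕ).factorial : K) ≠ 0) (hd : ∀ j : ℕ, j + 2 ≤ (M : ℕ) → d ≠ -2 * (j : K)) :
    ∑ s ∈ permsBelow n (M + 1), symmetrizer n d M * diag d (ofPerm s) * symmetrizer n d M =
      (M : ℕ).factorial • symmetrizer n d M + (M * (M : ℕ).factorial) •
        (symmetrizer n d M * diag d (ofPerm (Equiv.swap L M)) * symmetrizer n d M) := by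
  rw [← sum_filter_add_sum_filter_not (permsBelow n (M + 1)) fun s => s M = M,
    filter_permsBelow_succ]
  congr 1
  · refine (sum_congr rfl fun s hs => ?_).trans
      ((sum_const (symmetrizer n d M)).trans (by rw [card_permsBelow M.2.le]))
    rw [symmetrizer_mul_ofPerm hs, symmetrizer_mul_symmetrizer_of_le le_rfl M.2.le hM hd]
  · rw [← card_filter_permsBelow_succ_ne, ← sum_const]
    refine sum_congr rfl fun s hs => ?_
    obtain ⟨hs, hsM⟩ := mem_filter.1 hs
    exact symmetrizer_mul_ofPerm_mul_symmetrizer h hs hsM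

theorem sum_symmetrizer_mul_twist_mul_symmetrizer {L M : Fin n} (h : L < M) :
    ∑ s ∈ permsBelow n (M + 1) with s M ≠ M,
        symmetrizer n d M * diag d (twist M (ofPerm s)) * symmetrizer n d M =
      (M * (M : ℕ).factorial) •
        (symmetrizer n d M * diag d (cupCap L M h.ne) * symmetrizer n d M) := by
  rw [← card_filter_permsBelow_succ_ne, ← sum_const]
  refine sum_congr rfl fun s hs => ?_
  obtain ⟨hs, hsM⟩ := mem_filter.1 hs
  exact symmetrizer_mul_twist_mul_symmetrizer h hs hsM

theorem symmetrizer_succ {L M : Fin n} (h : L < M) (hM : ((M : ℕ).factorial : K) ≠ 0)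
    (hd : ∀ j : ℕ, j + 2 ≤ (M : ℕ) + 1 → d ≠ -2 * (j : K)) :
    symmetrizer n d (M + 1) =
      x K M • symmetrizer n d M +
        y d M • (symmetrizer n d M * diag d (cupCap L M h.ne) * symmetrizer n d M) +
        z K M • (symmetrizer n d M * diag d (ofPerm (Equiv.swap L M)) * symmetrizer n d M) := by
  rw [symmetrizer_succ_eq_sum hM hd, ← smul_sum, ← smul_sum,
    sum_symmetrizer_mul_ofPerm_mul_symmetrizer h hM fun j hj => hd j (by omega),
    sum_symmetrizer_mul_twist_mul_symmetrizer h, ← factorial_mul_weight_zero hM d,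
    ← mul_factorial_mul_weight_zero hM d, ← mul_factorial_mul_weight_one hM d]
  module

theorem symmetrizer_one (hn : 1 ≤ n) : symmetrizer n d 1 = 1 := by
  have not_hasCap (D : BrauerDiagram n) : ¬ HasCap 1 D := by
    rintro ⟨p, q, hp, hq, hpq⟩
    exact D.2.2 (Sum.inl p) (by rw [hpq, Fin.ext (show p.1 = q.1 by omega)])
  have one_mem : (1 : Equiv.Perm (Fin n)) ∈ permsBelow n 1 := mem_permsBelow.2 fun _ _ => rfl
  have card_le : #(permsBelow n 1) ≤ 1 := (card_permsBelow hn).le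
  have permsBelow_one : permsBelow n 1 = {1} :=
    eq_singleton_iff_unique_mem.2 ⟨one_mem, fun s hs => card_le_one.1 card_le s hs 1 one_mem⟩
  rw [symmetrizer, sum_verticalFrom_eq_sum_permsBelow fun D h => absurd h (not_hasCap D),
    permsBelow_one, sum_singleton, caps_ofPerm, weight_zero, Nat.factorial_one, Nat.cast_one,
    inv_one, one_smul]
  rfl

theorem f_succ_eq_symmetrizer {i : ℕ} (h : i + 1 ≤ n) (hi : ((i + 1).factorial : K) ≠ 0)
    (hd : ∀ j : ℕ, j + 2 ≤ i + 1 → d ≠ -2 * (j : K)) :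
    f n d (i + 1) h = symmetrizer n d (i + 1) := by
  induction i with
  | zero => rw [symmetrizer_one h]; rfl
  | succ i ih =>
    have hi' : ((i + 1).factorial : K) ≠ 0 := fun h0 => hi (by
      rw [Nat.factorial_succ, Nat.cast_mul, h0, mul_zero])
    rw [symmetrizer_succ (L := ⟨i, by omega⟩) (M := ⟨i + 1, h⟩) (Fin.mk_lt_mk.2 i.lt_succ_self)
      hi' hd, ← ih (by omega) hi' fun j hj => hd j (by omega)]
    rfl

theorem symmetrizer_self (n : ℕ) (d : K) :
    symmetrizer n d n = ∑ l ∈ range (n / 2 + 1), weight d n l • throughSum n d (n - 2 * l) := by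
  have verticalFrom_self : verticalFrom n n = univ :=
    eq_univ_iff_forall.2 fun D => mem_verticalFrom.2 fun i hi => absurd i.2 hi.not_gt
  have caps_mem (D : BrauerDiagram n) (_ : D ∈ univ) : D.caps ∈ range (n / 2 + 1) := by
    have := D.through_add_two_mul_caps
    exact mem_range.2 (by omega)
  rw [symmetrizer, verticalFrom_self, ← sum_fiberwise_of_maps_to caps_mem]
  refine sum_congr rfl fun l hl => ?_
  rw [throughSum, smul_sum]
  have caps_eq_iff (D : BrauerDiagram n) : D.caps = l ↔ D.through = n - 2 * l := by
    have := D.through_add_two_mul_caps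
    have := mem_range.1 hl
    omega
  simp only [caps_eq_iff]
  exact sum_congr rfl fun D hD => by rw [(caps_eq_iff D).2 (mem_filter.1 hD).2]

end VTL

theorem mainTheorem3_general {K : Type*} [Field K] (d : K) (n : ℕ) (hn : 1 ≤ n)
    (hfac : (n.factorial : K) ≠ 0) (hd : ∀ j : ℕ, j + 2 ≤ n → d ≠ -2 * (j : K)) :
    VTL.f n d n le_rfl =
      ∑ l ∈ Finset.range (n / 2 + 1),
        ((-2 : K) ^ l * (l.factorial : K) /
            ((n.factorial : K) * ∏ i ∈ Finset.Icc 1 l, (d + 2 * (n : K) - 2 - 2 * (i : K)))) •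
          VTL.throughSum n d (n - 2 * l) := by
  obtain ⟨i, rfl⟩ := Nat.exists_eq_add_of_le' hn
  exact (VTL.f_succ_eq_symmetrizer le_rfl hfac hd).trans (VTL.symmetrizer_self (i + 1) d)

theorem mainTheorem3 {K : Type*} [Field K] [CharZero K] (d : K) (n : ℕ) (hn : 1 ≤ n)
    (hd : ∀ j : ℕ, j + 2 ≤ n → d ≠ -2 * (j : K)) :
    VTL.f n d n le_rfl =
      ∑ l ∈ Finset.range (n / 2 + 1),
        ((-2 : K) ^ l * (l.factorial : K) /
            ((n.factorial : K) * ∏ i ∈ Finset.Icc 1 l, (d + 2 * (n : K) - 2 - 2 * (i : K)))) •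
          VTL.throughSum n d (n - 2 * l) := by
  exact mainTheorem3_general d n hn (Nat.cast_ne_zero.2 n.factorial_ne_zero) hd
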